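/- Let $d\ge 1$, let $u\in\mathbb C\setminus\{0\}$, and for $n\ge 0$ let $\mathrm Y_{d,n}(u)$ be the Yokonuma--Hecke algebra: the unital associative $\mathbb C$-algebra with generators $g_1,\dots,g_{n-1},t_1,\dots,t_n$ and relations $g_ig_j=g_jg_i$ for $|i-j|>1$; $g_{i+1}g_ig_{i+1}=g_ig_{i+1}g_i$; $t_it_j=t_jt_i$; $t_i^d=1$; $g_it_i=t_{i+1}g_i$; $g_it_{i+1}=t_ig_i$; $g_it_j=t_jg_i$ for $j\ne i,i+1$; $g_i^2=1+(u-1)e_i+(u-1)e_ig_i$, where $e_i=\frac1d\sum_{s=0}^{d-1}t_i^st_{i+1}^{d-s}$. For $m\in\mathbb Z/d\mathbb Z$ put $e_i^{(m)}=\frac1d\sum_{s=0}^{d-1}t_i^{m+s}t_{i+1}^{d-s}$. Let $z,x_1,\dots,x_{d-1}\in\mathbb C$, put $x_0=1$ and read the indices of the $x_k$ modulo $d$. Let $\mathrm{tr}$ be Juyumaya's Markov trace with these parameters, that is, the linear function on $\bigcup_n\mathrm Y_{d,n}(u)$ determined by $\mathrm{tr}(ab)=\mathrm{tr}(ba)$,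 $\mathrm{tr}(1)=1$, $\mathrm{tr}(ag_n)=z\,\mathrm{tr}(a)$ and $\mathrm{tr}(at_{n+1}^s)=x_s\,\mathrm{tr}(a)$ for $a,b\in\mathrm Y_{d,n}(u)$. Put $E^{(m)}=\frac1d\sum_{s\in\mathbb Z/d\mathbb Z}x_{m+s}x_{-s}$ (which is $\mathrm{tr}(e_i^{(m)})$). Let $g_{i,i+1}=1+g_i+g_{i+1}+g_ig_{i+1}+g_{i+1}g_i+g_ig_{i+1}g_i$. For $n\ge 3$ let $\mathrm{FTL}_{d,n}(u)$ be the quotient of $\mathrm Y_{d,n}(u)$ by the two-sided ideal generated by the elements $r_{i,i+1}=\sum_{a,b\in\mathbb Z/d\mathbb Z}t_i^at_{i+1}^{b-a}t_{i+2}^{-b}\,g_{i,i+1}$, and let $\mathrm{CTL}_{d,n}(u)$ be its quotient by the two-sided ideal generated by the elements $c_{i,i+1}=\sum_{a,b,c\in\mathbb Z/d\mathbb Z}t_i^at_{i+1}^bt_{i+2}^c\,g_{i,i+1}$ ($1\le i\le n-2$). One says that $\mathrm{tr}$ passes to such a quotient if its restriction to $\mathrm Y_{d,n}(u)$ factors through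 the canonical projection. Then, for every $n\ge 3$: 1. $\mathrm{tr}$ passes to $\mathrm{FTL}_{d,n}(u)$ if and only if $$(u+1)z^2x_k+(u+2)z\,E^{(k)}+\mathrm{tr}\big(e_1^{(k)}e_2\big)=0\qquad\text{for all }k\in\mathbb Z/d\mathbb Z .$$ 2. This is a restatement of the following criterion: $\mathrm{tr}$ passes to $\mathrm{FTL}_{d,n}(u)$ if and only if the support of the Fourier transform $\widehat x(m)=\sum_{k}x_k e^{-2\pi i km/d}$ is a disjoint union $S_1\sqcup S_2$ such that $|S_1|+(u+1)|S_2|\ne 0$, $$x_k=-z\Big(\sum_{m\in S_1}e^{2\pi i km/d}+(u+1)\sum_{m\in S_2}e^{2\pi i km/d}\Big)\ \ (k\in\mathbb Z/d\mathbb Z),\qquad z=-\frac1{|S_1|+(u+1)|S_2|}.$$ 3. Consequently the trace conditions for $\mathrm{FTL}_{d,n}(u)$ are contained in those for $\mathrm{CTL}_{d,n}(u)$: if $\mathrm{tr}$ passes to $\mathrm{FTL}_{d,n}(u)$, then $\mathrm{tr}$ passes to $\mathrm{CTL}_{d,n}(u)$, and $$(u+1)z^2\sum_{k}x_k+(u+2)z\sum_{k}E^{(k)}+\sum_{k}\mathrm{tr}\big(e_1^{(k)}e_2\big)=0,$$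 the sums being over $k\in\mathbb Z/d\mathbb Z$. -/

import Mathlib

noncomputable section

namespace YokonumaHecke

/-- Generators of the Yokonuma--Hecke algebra on `n` strands, indexed from `0`: `g i` is the
braiding generator exchanging the strands `i` and `i + 1`, and `t j` is the framing generator of
the strand `j`. (With indices starting from `1`, these are `g_{i+1}` and `t_{j+1}`.) -/
inductive Gen (n : ℕ) : Type
  | g (i : ℕ) (hi : i + 1 < n) : Gen n
  | t (j : ℕ) (hj : j < n) : Gen n

/-- The free generator `g_i`. -/
def fg {n : ℕ} (i : ℕ) (hi : i + 1 < n) : FreeAlgebra ℂ (Gen n) :=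
  FreeAlgebra.ι ℂ (Gen.g i hi)

/-- The free generator `t_j`. -/
def ft {n : ℕ} (j : ℕ) (hj : j < n) : FreeAlgebra ℂ (Gen n) :=
  FreeAlgebra.ι ℂ (Gen.t j hj)

/-- The word `e_i = d⁻¹ ∑_{s=0}^{d-1} t_i^s t_{i+1}^{d-s}` in the free algebra. -/
def fe (d : ℕ) {n : ℕ} (i : ℕ) (hi : i + 1 < n) : FreeAlgebra ℂ (Gen n) :=
  (1 / (d : ℂ)) •
    ∑ s ∈ Finset.range d, ft i (Nat.lt_of_succ_lt hi) ^ s * ft (i + 1) hi ^ (d - s)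

/-- The defining relations of the Yokonuma--Hecke algebra `Y_{d,n}(u)`. -/
inductive Rel (d n : ℕ) (u : ℂ) : FreeAlgebra ℂ (Gen n) → FreeAlgebra ℂ (Gen n) → Prop
  | g_comm (i j : ℕ) (hi : i + 1 < n) (hj : j + 1 < n) (hij : i + 1 < j ∨ j + 1 < i) :
      Rel d n u (fg i hi * fg j hj) (fg j hj * fg i hi)
  | braid (i : ℕ) (hi : i + 2 < n) :
      Rel d n u
        (fg (i + 1) hi * fg i (Nat.lt_of_succ_lt hi) * fg (i + 1) hi)
        (fg i (Nat.lt_of_succ_lt hi) * fg (i + 1) hi * fg i (Nat.lt_of_succ_lt hi))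
  | t_comm (i j : ℕ) (hi : i < n) (hj : j < n) :
      Rel d n u (ft i hi * ft j hj) (ft j hj * ft i hi)
  | t_pow (i : ℕ) (hi : i < n) : Rel d n u (ft i hi ^ d) 1
  | g_t (i : ℕ) (hi : i + 1 < n) :
      Rel d n u (fg i hi * ft i (Nat.lt_of_succ_lt hi)) (ft (i + 1) hi * fg i hi)
  | g_t_succ (i : ℕ) (hi : i + 1 < n) :
      Rel d n u (fg i hi * ft (i + 1) hi) (ft i (Nat.lt_of_succ_lt hi) * fg i hi)
  | g_t_of_ne (i j : ℕ) (hi : i + 1 < n) (hj : j < n) (h₁ : j ≠ i) (h₂ : j ≠ i + 1) :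
      Rel d n u (fg i hi * ft j hj) (ft j hj * fg i hi)
  | quadratic (i : ℕ) (hi : i + 1 < n) :
      Rel d n u (fg i hi ^ 2) (1 + (u - 1) • fe d i hi + (u - 1) • (fe d i hi * fg i hi))

/-- The Yokonuma--Hecke algebra `Y_{d,n}(u)`, by generators and relations. -/
abbrev Y (d n : ℕ) (u : ℂ) : Type := RingQuot (Rel d n u)

/-- The generator `g_i` of `Y_{d,n}(u)`. -/
def g (d : ℕ) {n : ℕ} (u : ℂ) (i : ℕ) (hi : i + 1 < n) : Y d n u :=
  RingQuot.mkAlgHom ℂ (Rel d n u) (fg i hi)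

/-- The generator `t_j` of `Y_{d,n}(u)`. -/
def t (d : ℕ) {n : ℕ} (u : ℂ) (j : ℕ) (hj : j < n) : Y d n u :=
  RingQuot.mkAlgHom ℂ (Rel d n u) (ft j hj)

/-- The power `t_j^a` for an exponent modulo `d` (well defined as `t_j^d = 1`). -/
def tpow {d n : ℕ} (u : ℂ) (j : ℕ) (hj : j < n) (a : ZMod d) : Y d n u := t d u j hj ^ a.val

/-- The generators of `n` strands, seen among the generators of `n + 1` strands. -/
def Gen.succ {n : ℕ} : Gen n → Gen (n + 1)
  | .g i hi => .g i (Nat.lt_succ_of_lt hi)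
  | .t j hj => .t j (Nat.lt_succ_of_lt hj)

/-- The map of free algebras sending each generator to the generator of the same name. -/
def freeIncl (n : ℕ) : FreeAlgebra ℂ (Gen n) →ₐ[ℂ] FreeAlgebra ℂ (Gen (n + 1)) :=
  FreeAlgebra.lift ℂ fun a => FreeAlgebra.ι ℂ a.succ

theorem freeIncl_fg {n : ℕ} (i : ℕ) (hi : i + 1 < n) :
    freeIncl n (fg i hi) = fg i (Nat.lt_succ_of_lt hi) := by
  simp [freeIncl, fg, Gen.succ]

theorem freeIncl_ft {n : ℕ} (j : ℕ) (hj : j < n) :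
    freeIncl n (ft j hj) = ft j (Nat.lt_succ_of_lt hj) := by
  simp [freeIncl, ft, Gen.succ]

theorem freeIncl_fe (d : ℕ) {n : ℕ} (i : ℕ) (hi : i + 1 < n) :
    freeIncl n (fe d i hi) = fe d i (Nat.lt_succ_of_lt hi) := by
  simp [fe, freeIncl_ft]

theorem freeIncl_rel {d n : ℕ} {u : ℂ} {a b : FreeAlgebra ℂ (Gen n)} (h : Rel d n u a b) :
    Rel d (n + 1) u (freeIncl n a) (freeIncl n b) := by
  induction h <;>
    simp only [map_mul, map_add, map_pow, map_one, map_smul, freeIncl_fg, freeIncl_ft, freeIncl_fe]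
  case g_comm i j hi hj hij => exact .g_comm i j _ _ hij
  case braid i hi => exact .braid i (Nat.lt_succ_of_lt hi)
  case t_comm i j hi hj => exact .t_comm i j _ _
  case t_pow i hi => exact .t_pow i _
  case g_t i hi => exact .g_t i (Nat.lt_succ_of_lt hi)
  case g_t_succ i hi => exact .g_t_succ i (Nat.lt_succ_of_lt hi)
  case g_t_of_ne i j hi hj h₁ h₂ => exact .g_t_of_ne i j _ _ h₁ h₂
  case quadratic i hi => exact .quadratic i (Nat.lt_succ_of_lt hi)

/-- The natural map `Y_{d,n}(u) → Y_{d,n+1}(u)` through which the union of the tower is formed. -/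
def incl (d n : ℕ) (u : ℂ) : Y d n u →ₐ[ℂ] Y d (n + 1) u :=
  RingQuot.liftAlgHom ℂ
    ⟨(RingQuot.mkAlgHom ℂ (Rel d (n + 1) u)).comp (freeIncl n),
      fun _ _ h => RingQuot.mkAlgHom_rel ℂ (freeIncl_rel h)⟩

/-- `tr` is the Markov trace with parameters `z` and `x_1, …, x_{d-1}` on the tower of
Yokonuma--Hecke algebras, given by its inductive rules (used with `x 0 = 1`). The rule `incl` says
that `tr` is one function on the union of the tower. -/
structure IsMarkovTrace (d : ℕ) (u z : ℂ) (x : ZMod d → ℂ)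
    (tr : ∀ n : ℕ, Y d n u →ₗ[ℂ] ℂ) : Prop where
  incl : ∀ (n : ℕ) (a : Y d n u), tr (n + 1) (incl d n u a) = tr n a
  comm : ∀ (n : ℕ) (a b : Y d n u), tr n (a * b) = tr n (b * a)
  one : ∀ n : ℕ, tr n 1 = 1
  markov : ∀ (n : ℕ) (a : Y d (n + 1) u),
    tr (n + 2) (YokonumaHecke.incl d (n + 1) u a * g d u n (Nat.lt_succ_self (n + 1)))
      = z * tr (n + 1) a
  framing : ∀ (n : ℕ) (a : Y d n u) (s : ZMod d),
    tr (n + 1) (YokonumaHecke.incl d n u a * tpow u n (Nat.lt_succ_self n) s) = x s * tr n a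

/-- The shifted idempotent `e_i^{(m)} = d⁻¹ ∑_{s=0}^{d-1} t_i^{m+s} t_{i+1}^{d-s}`. -/
def eShift {d n : ℕ} (u : ℂ) (i : ℕ) (hi : i + 1 < n) (m : ZMod d) : Y d n u :=
  (1 / (d : ℂ)) • ∑ s ∈ Finset.range d,
    t d u i (Nat.lt_of_succ_lt hi) ^ (m.val + s) * t d u (i + 1) hi ^ (d - s)

/-- `E^{(m)} = d⁻¹ ∑_s x_{m+s} x_{d-s}`, the value of the trace at every `e_i^{(m)}`. -/
def EShift {d : ℕ} [NeZero d] (x : ZMod d → ℂ) (m : ZMod d) : ℂ :=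
  (1 / (d : ℂ)) * ∑ s : ZMod d, x (m + s) * x (-s)

/-- The Steinberg element `g_{i,i+1} = ∑ g_w`, over the six elements
`1, s_i, s_{i+1}, s_i s_{i+1}, s_{i+1} s_i, s_i s_{i+1} s_i` of the subgroup `⟨s_i, s_{i+1}⟩`. -/
def steinberg (d : ℕ) {n : ℕ} (u : ℂ) (i : ℕ) (hi : i + 2 < n) : Y d n u :=
  1 + g d u i (Nat.lt_of_succ_lt hi) + g d u (i + 1) hi
    + g d u i (Nat.lt_of_succ_lt hi) * g d u (i + 1) hi
    + g d u (i + 1) hi * g d u i (Nat.lt_of_succ_lt hi)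
    + g d u i (Nat.lt_of_succ_lt hi) * g d u (i + 1) hi * g d u i (Nat.lt_of_succ_lt hi)

/-- `r_{i,i+1} = ∑ g_h` over `h` in `⟨t_i t_{i+1}⁻¹, t_{i+1} t_{i+2}⁻¹⟩ ⋊ ⟨s_i, s_{i+1}⟩`: the
elements of this group are the `t_i^a t_{i+1}^{b-a} t_{i+2}^{-b} w`, each for exactly one choice of
`a, b` modulo `d` and `w`, and then `g_h = t_i^a t_{i+1}^{b-a} t_{i+2}^{-b} g_w`. -/
def rElt (d : ℕ) [NeZero d] {n : ℕ} (u : ℂ) (i : ℕ) (hi : i + 2 < n) : Y d n u :=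
  ∑ a : ZMod d, ∑ b : ZMod d,
    tpow u i (by omega) a * tpow u (i + 1) (by omega) (b - a) * tpow u (i + 2) hi (-b)
      * steinberg d u i hi

/-- `c_{i,i+1} = ∑ g_c` over `c` in `⟨t_i, t_{i+1}, t_{i+2}⟩ ⋊ ⟨s_i, s_{i+1}⟩`. -/
def cElt (d : ℕ) [NeZero d] {n : ℕ} (u : ℂ) (i : ℕ) (hi : i + 2 < n) : Y d n u :=
  ∑ a : ZMod d, ∑ b : ZMod d, ∑ c : ZMod d,
    tpow u i (by omega) a * tpow u (i + 1) (by omega) b * tpow u (i + 2) hi c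
      * steinberg d u i hi

/-- The two-sided ideal generated by all the `r_{i,i+1}`. -/
def ftlIdeal (d : ℕ) [NeZero d] (n : ℕ) (u : ℂ) : TwoSidedIdeal (Y d n u) :=
  TwoSidedIdeal.span {y | ∃ (i : ℕ) (hi : i + 2 < n), y = rElt d u i hi}

/-- The two-sided ideal generated by all the `c_{i,i+1}`. -/
def ctlIdeal (d : ℕ) [NeZero d] (n : ℕ) (u : ℂ) : TwoSidedIdeal (Y d n u) :=
  TwoSidedIdeal.span {y | ∃ (i : ℕ) (hi : i + 2 < n), y = cElt d u i hi}

/-- The Framization of the Temperley--Lieb algebra, `FTL_{d,n}(u)`. -/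
abbrev FTL (d : ℕ) [NeZero d] (n : ℕ) (u : ℂ) : Type := (ftlIdeal d n u).ringCon.Quotient

/-- The Complex Reflection Temperley--Lieb algebra, `CTL_{d,n}(u)`. -/
abbrev CTL (d : ℕ) [NeZero d] (n : ℕ) (u : ℂ) : Type := (ctlIdeal d n u).ringCon.Quotient

/-- A linear functional on `Y_{d,n}(u)` passes to `FTL_{d,n}(u)`: it factors through the canonical
projection. -/
def PassesToFTL {d : ℕ} [NeZero d] {n : ℕ} {u : ℂ} (τ : Y d n u →ₗ[ℂ] ℂ) : Prop :=
  ∃ f : FTL d n u →ₗ[ℂ] ℂ, f ∘ₗ ((ftlIdeal d n u).ringCon.mkₐ (α := ℂ)).toLinearMap = τ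

/-- A linear functional on `Y_{d,n}(u)` passes to `CTL_{d,n}(u)`: it factors through the canonical
projection. -/
def PassesToCTL {d : ℕ} [NeZero d] {n : ℕ} {u : ℂ} (τ : Y d n u →ₗ[ℂ] ℂ) : Prop :=
  ∃ f : CTL d n u →ₗ[ℂ] ℂ, f ∘ₗ ((ctlIdeal d n u).ringCon.mkₐ (α := ℂ)).toLinearMap = τ

/-- The parameters have the form
`x_k = -z (∑_{m ∈ S₁} χ(km) + (u+1) ∑_{m ∈ S₂} χ(km))` and `z = -1 / (|S₁| + (u+1)|S₂|)`, where
`χ(k) = exp(2πik/d)` and the support of the Fourier transform of `x` is the disjoint union of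
`S₁` and `S₂`. -/
def SupportCondition {d : ℕ} [NeZero d] (u z : ℂ) (x : ZMod d → ℂ) : Prop :=
  ∃ S₁ S₂ : Finset (ZMod d), Disjoint S₁ S₂ ∧
    (S₁ : Set (ZMod d)) ∪ S₂ = Function.support (ZMod.dft x) ∧
    (∀ k : ZMod d, x k = -z * (∑ m ∈ S₁, ZMod.stdAddChar (k * m)
      + (u + 1) * ∑ m ∈ S₂, ZMod.stdAddChar (k * m))) ∧
    (S₁.card : ℂ) + (u + 1) * S₂.card ≠ 0 ∧
    z = -1 / ((S₁.card : ℂ) + (u + 1) * S₂.card)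

end YokonumaHecke

end

/-!
Put `e_i = e_i^{(0)}`. Since `r_{i,i+1} = d² e_i e_{i+1} g_{i,i+1}` and `e_i e_{i+1}` commutes with
`g_i` and `g_{i+1}`, the quadratic relation gives `g_i r = u r = g_{i+1} r` for `r = r_{i,i+1}`,
while `t_{i+1}` and `t_{i+2}` act on `r` as `t_i` does. So the left ideal of `r_{1,2}` in
`Y_{d,3}(u)` is spanned by the `t_1^k r_{1,2}`, whose traces are `d²` times the left-hand sides of
the system of equations. For larger `n` every element is a combination of words `a t_n^s` and
`a g_{n-1} b`, with `a` and `b` from `n - 1` strands, so the rules of the trace carry the vanishing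
on the left ideal of `r_{1,2}` from one level to the next. As the `g_i` are invertible for `u ≠ 0`,
`r_{i+1,i+2}` is the conjugate of `r_{i,i+1}` by `g_i g_{i+1} g_{i+2}`, and a trace which vanishes
on one left ideal vanishes on the other.

The Fourier transform turns convolutions into products, hence the system into the condition that
every value of the transform of `x` is a root of `X (X + d z) (X + d z (u + 1))`. The sets `S₁` and
`S₂` record where the two possibly nonzero roots are attained, and Fourier inversion at `0` together
with `x_0 = 1` gives `z`. Finally `c_{i,i+1} = ∑_k t_i^k r_{i,i+1}`, so the second ideal lies in the
first.
-/

namespace YokonumaHecke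

section Relations

variable {d n : ℕ} {u : ℂ} {i j : ℕ}

theorem commute_g_g (hi : i + 1 < n) (hj : j + 1 < n) (hij : i + 1 < j ∨ j + 1 < i) :
    Commute (g d u i hi) (g d u j hj) := by
  simpa only [map_mul] using! RingQuot.mkAlgHom_rel ℂ (Rel.g_comm (d := d) (u := u) i j hi hj hij)

theorem g_braid (hi : i + 2 < n) :
    g d u (i + 1) hi * g d u i (by omega) * g d u (i + 1) hi
      = g d u i (by omega) * g d u (i + 1) hi * g d u i (by omega) := by
  simpa only [map_mul] using! RingQuot.mkAlgHom_rel ℂ (Rel.braid (d := d) (u := u) i hi)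

theorem t_pow_eq_one (hi : i < n) : t d u i hi ^ d = 1 := by
  simpa only [map_pow, map_one] using! RingQuot.mkAlgHom_rel ℂ (Rel.t_pow (d := d) (u := u) i hi)

theorem commute_tpow_tpow (hi : i < n) (hj : j < n) (a b : ZMod d) :
    Commute (tpow u i hi a : Y d n u) (tpow u j hj b) := by
  have h : Commute (t d u i hi) (t d u j hj) := by
    simpa only [map_mul] using! RingQuot.mkAlgHom_rel ℂ (Rel.t_comm (d := d) (u := u) i j hi hj)
  exact h.pow_pow _ _

theorem g_mul_tpow (hi : i + 1 < n) (a : ZMod d) :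
    g d u i hi * tpow u i (by omega) a = tpow u (i + 1) hi a * g d u i hi := by
  have h : SemiconjBy (g d u i hi) (t d u i (by omega)) (t d u (i + 1) hi) := by
    simpa only [map_mul] using! RingQuot.mkAlgHom_rel ℂ (Rel.g_t (d := d) (u := u) i hi)
  exact h.pow_right _

theorem g_mul_tpow_succ (hi : i + 1 < n) (a : ZMod d) :
    g d u i hi * tpow u (i + 1) hi a = tpow u i (by omega) a * g d u i hi := by
  have h : SemiconjBy (g d u i hi) (t d u (i + 1) hi) (t d u i (by omega)) := by
    simpa only [map_mul] using! RingQuot.mkAlgHom_rel ℂ (Rel.g_t_succ (d := d) (u := u) i hi)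
  exact h.pow_right _

theorem commute_g_tpow (hi : i + 1 < n) (hj : j < n) (h₁ : j ≠ i) (h₂ : j ≠ i + 1) (a : ZMod d) :
    Commute (g d u i hi) (tpow u j hj a) := by
  have h : Commute (g d u i hi) (t d u j hj) := by
    simpa only [map_mul] using!
      RingQuot.mkAlgHom_rel ℂ (Rel.g_t_of_ne (d := d) (u := u) i j hi hj h₁ h₂)
  exact h.pow_right _

theorem t_pow_eq_tpow (hj : j < n) (k : ℕ) : t d u j hj ^ k = tpow u j hj (k : ZMod d) := by
  rw [tpow, ZMod.val_natCast, ← pow_eq_pow_mod k (t_pow_eq_one hj)]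

theorem t_eq_tpow_one (hj : j < n) : t d u j hj = tpow u j hj (1 : ZMod d) := by
  simpa using! t_pow_eq_tpow (d := d) (u := u) hj 1

theorem tpow_zero (hj : j < n) : (tpow u j hj (0 : ZMod d) : Y d n u) = 1 := by
  simp [tpow]

theorem tpow_add [NeZero d] (hj : j < n) (a b : ZMod d) :
    (tpow u j hj (a + b) : Y d n u) = tpow u j hj a * tpow u j hj b := by
  rw [tpow, tpow, tpow, ← pow_add, ZMod.val_add, ← pow_eq_pow_mod _ (t_pow_eq_one hj)]

theorem eq_top_of_generator_mul_mem {S : Submodule ℂ (Y d n u)} (one : 1 ∈ S)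
    (hg : ∀ i hi, ∀ a ∈ S, g d u i hi * a ∈ S) (ht : ∀ j hj, ∀ a ∈ S, t d u j hj * a ∈ S) :
    S = ⊤ := by
  refine (Submodule.eq_top_iff').2 fun a => ?_
  obtain ⟨w, rfl⟩ := RingQuot.mkAlgHom_surjective ℂ (Rel d n u) a
  suffices h : ∀ b ∈ S, RingQuot.mkAlgHom ℂ (Rel d n u) w * b ∈ S by simpa using h 1 one
  induction w using FreeAlgebra.induction with
  | grade0 r =>
    intro b hb
    rw [AlgHom.commutes, ← Algebra.smul_def]
    exact S.smul_mem r hb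
  | grade1 a =>
    cases a with
    | g i hi => exact hg i hi
    | t j hj => exact ht j hj
  | mul a b ha hb =>
    intro c hc
    rw [map_mul, mul_assoc]
    exact ha _ (hb c hc)
  | add a b ha hb =>
    intro c hc
    rw [map_add, add_mul]
    exact S.add_mem (ha c hc) (hb c hc)

theorem commute_algHom_of_commute_generators {B : Type*} [Ring B] [Algebra ℂ B]
    (φ : Y d n u →ₐ[ℂ] B) {b : B} (hg : ∀ i hi, Commute b (φ (g d u i hi)))
    (ht : ∀ j hj, Commute b (φ (t d u j hj))) (a : Y d n u) : Commute b (φ a) := by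
  let S : Submodule ℂ (Y d n u) :=
    Subalgebra.toSubmodule ((Subalgebra.centralizer ℂ {b}).comap φ)
  have mem_S {a} : a ∈ S ↔ Commute b (φ a) := by
    simp [S, Subalgebra.mem_centralizer_iff, Commute, SemiconjBy]
  have hS : S = ⊤ := eq_top_of_generator_mul_mem (by simp [mem_S])
    (fun i hi a ha => mem_S.2 <| by rw [map_mul]; exact (hg i hi).mul_right (mem_S.1 ha))
    (fun j hj a ha => mem_S.2 <| by rw [map_mul]; exact (ht j hj).mul_right (mem_S.1 ha))
  exact mem_S.1 (hS ▸ Submodule.mem_top)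

end Relations

section Idempotents

variable {d n : ℕ} {u : ℂ} {i j : ℕ}

/-- The idempotent `e_i = e_i^{(0)}` of the paper. -/
noncomputable def e (d : ℕ) {n : ℕ} (u : ℂ) (i : ℕ) (hi : i + 1 < n) : Y d n u :=
  eShift u i hi (0 : ZMod d)

theorem g_mul_g (hi : i + 1 < n) :
    g d u i hi * g d u i hi = 1 + (u - 1) • e d u i hi + (u - 1) • (e d u i hi * g d u i hi) := by
  have h := RingQuot.mkAlgHom_rel ℂ (Rel.quadratic (d := d) (u := u) i hi)
  have he : RingQuot.mkAlgHom ℂ (Rel d n u) (fe d i hi) = e d u i hi := by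
    simp [fe, e, eShift, t]
  simpa only [map_add, map_mul, map_pow, map_one, map_smul, he, pow_two] using! h

variable [NeZero d]

theorem sum_range_eq_sum_zmod {M : Type*} [AddCommMonoid M] (f : ℕ → M) :
    ∑ s ∈ Finset.range d, f s = ∑ s : ZMod d, f s.val := by
  obtain ⟨k, rfl⟩ := Nat.exists_eq_succ_of_ne_zero (NeZero.ne d)
  exact Finset.sum_range f

theorem eShift_eq_tpow_mul_sum (hi : i + 1 < n) (m : ZMod d) :
    (eShift u i hi m : Y d n u) = tpow u i (by omega) m *
      ((1 / (d : ℂ)) • ∑ s : ZMod d, tpow u i (by omega) s * tpow u (i + 1) hi (-s)) := by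
  rw [eShift, sum_range_eq_sum_zmod, mul_smul_comm, Finset.mul_sum]
  congr! 2 with s
  rw [t_pow_eq_tpow, t_pow_eq_tpow, Nat.cast_sub s.val_le, ← mul_assoc, ← tpow_add]
  simp

theorem e_eq_sum (hi : i + 1 < n) :
    e d u i hi =
      (1 / (d : ℂ)) • ∑ s : ZMod d, tpow u i (by omega) s * tpow u (i + 1) hi (-s) := by
  rw [e, eShift_eq_tpow_mul_sum, tpow_zero, one_mul]

theorem eShift_eq_tpow_mul_e (hi : i + 1 < n) (m : ZMod d) :
    (eShift u i hi m : Y d n u) = tpow u i (by omega) m * e d u i hi := by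
  rw [eShift_eq_tpow_mul_sum, e_eq_sum]

theorem one_div_smul_sum_const {𝕜 M : Type*} [DivisionRing 𝕜] [CharZero 𝕜] [AddCommGroup M]
    [Module 𝕜 M] (y : M) : (1 / (d : 𝕜)) • ∑ _s : ZMod d, y = y := by
  rw [Finset.sum_const, Finset.card_univ, ZMod.card, ← Nat.cast_smul_eq_nsmul 𝕜, smul_smul,
    one_div, inv_mul_cancel₀ (NeZero.ne _), one_smul]

theorem tpow_succ_mul_e (hi : i + 1 < n) (m : ZMod d) :
    tpow u (i + 1) hi m * e d u i hi = tpow u i (by omega) m * e d u i hi := by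
  simp only [e_eq_sum, mul_smul_comm, Finset.mul_sum]
  congr 1
  rw [← Equiv.sum_comp (Equiv.addRight m)]
  refine Finset.sum_congr rfl fun s _ => ?_
  rw [(commute_tpow_tpow hi _ _ _).left_comm, ← tpow_add, ← mul_assoc, ← tpow_add]
  simp [add_comm m s]

theorem commute_e_of_commute_tpow (hi : i + 1 < n) {y : Y d n u}
    (h₀ : ∀ s : ZMod d, Commute y (tpow u i (by omega) s))
    (h₁ : ∀ s : ZMod d, Commute y (tpow u (i + 1) hi s)) : Commute y (e d u i hi) := by
  rw [e_eq_sum]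
  exact (Commute.sum_right _ _ _ fun s _ => (h₀ s).mul_right (h₁ (-s))).smul_right _

theorem commute_tpow_e (hj : j < n) (hi : i + 1 < n) (m : ZMod d) :
    Commute (tpow u j hj m) (e d u i hi) :=
  commute_e_of_commute_tpow hi (commute_tpow_tpow hj _ m) (commute_tpow_tpow hj hi m)

theorem commute_e_e (hi : i + 1 < n) (hj : j + 1 < n) : Commute (e d u i hi) (e d u j hj) :=
  commute_e_of_commute_tpow hj (fun s => (commute_tpow_e _ hi s).symm)
    fun s => (commute_tpow_e hj hi s).symm

theorem isIdempotentElem_e (hi : i + 1 < n) : IsIdempotentElem (e d u i hi) := by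
  have absorb (s : ZMod d) :
      tpow u i (by omega) s * tpow u (i + 1) hi (-s) * e d u i hi = e d u i hi := by
    rw [mul_assoc, tpow_succ_mul_e, ← mul_assoc, ← tpow_add, add_neg_cancel, tpow_zero, one_mul]
  rw [IsIdempotentElem]
  nth_rw 1 [e_eq_sum]
  simp only [smul_mul_assoc, Finset.sum_mul, absorb]
  exact one_div_smul_sum_const _

theorem commute_g_e (hi : i + 1 < n) : Commute (g d u i hi) (e d u i hi) := by
  rw [Commute, SemiconjBy, e_eq_sum, mul_smul_comm, smul_mul_assoc, Finset.mul_sum, Finset.sum_mul]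
  congr 1
  rw [← Equiv.sum_comp (Equiv.neg _)]
  refine Finset.sum_congr rfl fun s _ => ?_
  rw [← mul_assoc, g_mul_tpow, mul_assoc, g_mul_tpow_succ, ← mul_assoc,
    (commute_tpow_tpow hi _ _ _).eq, Equiv.neg_apply, neg_neg]

theorem e_mul_g_mul_g (hi : i + 1 < n) :
    e d u i hi * (g d u i hi * g d u i hi)
      = u • e d u i hi + (u - 1) • (e d u i hi * g d u i hi) := by
  rw [g_mul_g, mul_add, mul_add, mul_one, mul_smul_comm, mul_smul_comm, ← mul_assoc,
    (isIdempotentElem_e hi).eq]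
  module

theorem e_mul_one_add_g_mul_g (hi : i + 1 < n) :
    e d u i hi * (1 + g d u i hi) * g d u i hi = u • (e d u i hi * (1 + g d u i hi)) := by
  rw [mul_assoc, add_mul, one_mul, mul_add, e_mul_g_mul_g, mul_add, mul_one]
  module

theorem e_mul_one_add_g_mul_tpow_succ (hi : i + 1 < n) (s : ZMod d) :
    e d u i hi * (1 + g d u i hi) * tpow u (i + 1) hi s
      = tpow u i (by omega) s * (e d u i hi * (1 + g d u i hi)) := by
  rw [mul_assoc, add_mul, one_mul, g_mul_tpow_succ, mul_add, ← (commute_tpow_e hi hi s).eq,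
    tpow_succ_mul_e, ← mul_assoc (e d u i hi), ← (commute_tpow_e _ hi s).eq, mul_assoc, ← mul_add,
    ← mul_one_add]

theorem isUnit_one_add_sub_one_smul {𝕜 A : Type*} [Field 𝕜] [Ring A] [Algebra 𝕜 A] {f : A}
    (hf : IsIdempotentElem f) {c : 𝕜} (hc : c ≠ 0) : IsUnit (1 + (c - 1) • f) := by
  have inv {a b : 𝕜} (hab : a * b = 1) : (1 + (a - 1) • f) * (1 + (b - 1) • f) = 1 := by
    simp only [add_mul, mul_add, one_mul, mul_one, smul_mul_smul_comm, hf.eq]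
    match_scalars
    · ring
    · linear_combination hab
  exact ⟨⟨_, 1 + (c⁻¹ - 1) • f, inv (mul_inv_cancel₀ hc), inv (inv_mul_cancel₀ hc)⟩, rfl⟩

theorem isUnit_g (hu : u ≠ 0) (hi : i + 1 < n) : IsUnit (g d u i hi) := by
  have hcomm : Commute (g d u i hi) (g d u i hi - (u - 1) • e d u i hi) :=
    (Commute.refl _).sub_right ((commute_g_e hi).smul_right _)
  have hmul : g d u i hi * (g d u i hi - (u - 1) • e d u i hi) = 1 + (u - 1) • e d u i hi := by
    rw [mul_sub, mul_smul_comm, (commute_g_e hi).eq, g_mul_g, add_sub_cancel_right]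
  exact (hcomm.isUnit_mul_iff.1
    (hmul ▸ isUnit_one_add_sub_one_smul (isIdempotentElem_e hi) hu)).1

theorem commute_g_e_mul_e (hi : i + 2 < n) :
    Commute (g d u i (by omega)) (e d u i (by omega) * e d u (i + 1) hi) := by
  have h₁ : i + 1 < n := by omega
  have move (s : ZMod d) :
      g d u i h₁ * (tpow u (i + 1) h₁ s * tpow u (i + 2) hi (-s) * e d u i h₁)
        = tpow u (i + 1) h₁ s * tpow u (i + 2) hi (-s) * e d u i h₁ * g d u i h₁ := by
    calc g d u i h₁ * (tpow u (i + 1) h₁ s * tpow u (i + 2) hi (-s) * e d u i h₁)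
        = tpow u i (by omega) s * tpow u (i + 2) hi (-s) * e d u i h₁ * g d u i h₁ := by
          rw [mul_assoc, ← mul_assoc, g_mul_tpow_succ, mul_assoc _ (g d u i h₁),
            (commute_g_tpow h₁ hi (by omega) (by omega) _).left_comm, (commute_g_e h₁).eq]
          simp only [mul_assoc]
      _ = _ := by
          congr 1
          rw [(commute_tpow_tpow _ hi s (-s)).eq, (commute_tpow_tpow _ hi s (-s)).eq, mul_assoc,
            mul_assoc, tpow_succ_mul_e]
  rw [(commute_e_e h₁ hi).eq, e_eq_sum hi, smul_mul_assoc, Finset.sum_mul]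
  refine Commute.smul_right (Commute.sum_right _ _ _ fun s _ => ?_) _
  exact move s

theorem commute_g_succ_e_mul_e (hi : i + 2 < n) :
    Commute (g d u (i + 1) hi) (e d u i (by omega) * e d u (i + 1) hi) := by
  have h₁ : i + 1 < n := by omega
  have h₀ : i < n := by omega
  have move (s : ZMod d) :
      g d u (i + 1) hi * (tpow u i h₀ s * tpow u (i + 1) h₁ (-s) * e d u (i + 1) hi)
        = tpow u i h₀ s * tpow u (i + 1) h₁ (-s) * e d u (i + 1) hi * g d u (i + 1) hi := by
    rw [mul_assoc, (commute_g_tpow hi h₀ (by omega) (by omega) s).left_comm,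
      ← mul_assoc (g d u (i + 1) hi), g_mul_tpow, mul_assoc _ (g d u (i + 1) hi),
      (commute_g_e hi).eq, ← mul_assoc (tpow u (i + 2) hi (-s)), tpow_succ_mul_e]
    simp only [mul_assoc]
  rw [e_eq_sum h₁, smul_mul_assoc, Finset.sum_mul]
  exact Commute.smul_right (Commute.sum_right _ _ _ fun s _ => move s) _

end Idempotents

section Steinberg

theorem mul_mul_one_add_of_quadratic {𝕜 A : Type*} [CommRing 𝕜] [Ring A] [Algebra 𝕜 A] {a f : A}
    {c : 𝕜} (hcomm : Commute a f) (hquad : f * (a * a) = c • f + (c - 1) • (f * a)) :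
    a * (f * (1 + a)) = c • (f * (1 + a)) := by
  rw [hcomm.left_comm, mul_add, mul_add, mul_one, hquad, mul_add, mul_one]
  module

variable {d n : ℕ} {u : ℂ} {i : ℕ}

theorem steinberg_eq_one_add_g_mul (hi : i + 2 < n) :
    steinberg d u i hi = (1 + g d u i (by omega)) *
      (1 + g d u (i + 1) hi + g d u (i + 1) hi * g d u i (by omega)) := by
  rw [steinberg]
  noncomm_ring

theorem steinberg_eq_one_add_g_succ_mul (hi : i + 2 < n) :
    steinberg d u i hi = (1 + g d u (i + 1) hi) *
      (1 + g d u i (by omega) + g d u i (by omega) * g d u (i + 1) hi) := by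
  rw [steinberg, ← g_braid]
  noncomm_ring

/-- The product `g_i g_{i+1} g_{i+2}`, a lift of the cycle `i ↦ i + 1 ↦ i + 2 ↦ i + 3 ↦ i`. It is
used to conjugate `r_{i,i+1}` into `r_{i+1,i+2}`. -/
noncomputable def gCycle (d : ℕ) {n : ℕ} (u : ℂ) (i : ℕ) (hi : i + 3 < n) : Y d n u :=
  g d u i (by omega) * g d u (i + 1) (by omega) * g d u (i + 2) hi

theorem semiconjBy_gCycle_tpow (hi : i + 3 < n) (j : ℕ) (h₁ : i ≤ j) (h₂ : j ≤ i + 2)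
    (s : ZMod d) :
    SemiconjBy (gCycle d u i hi) (tpow u j (by omega) s) (tpow u (j + 1) (by omega) s) := by
  obtain rfl | rfl | rfl : j = i ∨ j = i + 1 ∨ j = i + 2 := by omega
  · exact (SemiconjBy.mul_left (g_mul_tpow _ s)
      (commute_g_tpow _ _ (by omega) (by omega) s)).mul_left
      (commute_g_tpow _ _ (by omega) (by omega) s)
  · exact (SemiconjBy.mul_left (commute_g_tpow _ _ (by omega) (by omega) s)
      (g_mul_tpow _ s)).mul_left (commute_g_tpow _ _ (by omega) (by omega) s)
  · exact (SemiconjBy.mul_left (commute_g_tpow _ _ (by omega) (by omega) s)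
      (commute_g_tpow _ _ (by omega) (by omega) s)).mul_left (g_mul_tpow hi s)

theorem semiconjBy_gCycle_g (hi : i + 3 < n) (j : ℕ) (h₁ : i ≤ j) (h₂ : j ≤ i + 1) :
    SemiconjBy (gCycle d u i hi) (g d u j (by omega)) (g d u (j + 1) (by omega)) := by
  rw [SemiconjBy, gCycle]
  obtain rfl | rfl : j = i ∨ j = i + 1 := by omega
  · rw [mul_assoc, (commute_g_g hi _ (by omega)).eq, ← mul_assoc, ← g_braid]
    simp only [mul_assoc]
  · rw [mul_assoc, mul_assoc, ← mul_assoc (g d u (i + 1) _) (g d u (i + 2) _), ← g_braid,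
      mul_assoc, (commute_g_g _ hi (by omega)).left_comm]
    simp only [mul_assoc]

theorem semiconjBy_gCycle_steinberg (hi : i + 3 < n) :
    SemiconjBy (gCycle d u i hi) (steinberg d u i (by omega)) (steinberg d u (i + 1) hi) := by
  have h₀ := semiconjBy_gCycle_g (d := d) (u := u) hi i (by omega) (by omega)
  have h₁ := semiconjBy_gCycle_g (d := d) (u := u) hi (i + 1) (by omega) (by omega)
  exact (((((SemiconjBy.one_right _).add_right h₀).add_right h₁).add_right
    (h₀.mul_right h₁)).add_right (h₁.mul_right h₀)).add_right ((h₀.mul_right h₁).mul_right h₀)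

variable [NeZero d]

theorem rElt_eq (hi : i + 2 < n) :
    rElt d u i hi
      = (d : ℂ) ^ 2 • (e d u i (by omega) * e d u (i + 1) hi * steinberg d u i hi) := by
  have hd : (d : ℂ) ^ 2 * (1 / d * (1 / d)) = 1 := by
    have : (d : ℂ) ≠ 0 := NeZero.ne _
    field_simp
  rw [e_eq_sum, e_eq_sum hi, smul_mul_smul_comm, smul_mul_assoc, smul_smul, hd, one_smul,
    Finset.sum_mul_sum, Finset.sum_mul, rElt]
  refine Finset.sum_congr rfl fun a _ => ?_
  rw [Finset.sum_mul]
  refine Finset.sum_congr rfl fun b _ => ?_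
  rw [sub_eq_neg_add, tpow_add]
  simp only [mul_assoc]

theorem g_mul_rElt (hi : i + 2 < n) :
    g d u i (by omega) * rElt d u i hi = u • rElt d u i hi := by
  have h₁ : i + 1 < n := by omega
  have hquad : e d u i h₁ * e d u (i + 1) hi * (g d u i h₁ * g d u i h₁)
      = u • (e d u i h₁ * e d u (i + 1) hi)
        + (u - 1) • (e d u i h₁ * e d u (i + 1) hi * g d u i h₁) := by
    rw [(commute_e_e h₁ hi).eq, mul_assoc, e_mul_g_mul_g, mul_add, mul_smul_comm, mul_smul_comm,
      mul_assoc]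
  rw [rElt_eq, mul_smul_comm, smul_comm u, steinberg_eq_one_add_g_mul, ← mul_assoc (e d u i h₁ * _),
    ← mul_assoc, mul_mul_one_add_of_quadratic (commute_g_e_mul_e hi) hquad, smul_mul_assoc]

theorem g_succ_mul_rElt (hi : i + 2 < n) :
    g d u (i + 1) hi * rElt d u i hi = u • rElt d u i hi := by
  have h₁ : i + 1 < n := by omega
  have hquad : e d u i h₁ * e d u (i + 1) hi * (g d u (i + 1) hi * g d u (i + 1) hi)
      = u • (e d u i h₁ * e d u (i + 1) hi)
        + (u - 1) • (e d u i h₁ * e d u (i + 1) hi * g d u (i + 1) hi) := by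
    rw [mul_assoc, e_mul_g_mul_g, mul_add, mul_smul_comm, mul_smul_comm, mul_assoc]
  rw [rElt_eq, mul_smul_comm, smul_comm u, steinberg_eq_one_add_g_succ_mul,
    ← mul_assoc (e d u i h₁ * _), ← mul_assoc,
    mul_mul_one_add_of_quadratic (commute_g_succ_e_mul_e hi) hquad, smul_mul_assoc]

theorem tpow_succ_mul_rElt (hi : i + 2 < n) (m : ZMod d) :
    tpow u (i + 1) (by omega) m * rElt d u i hi = tpow u i (by omega) m * rElt d u i hi := by
  rw [rElt_eq, mul_smul_comm, mul_smul_comm]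
  simp only [← mul_assoc]
  rw [tpow_succ_mul_e]

theorem tpow_add_two_mul_rElt (hi : i + 2 < n) (m : ZMod d) :
    tpow u (i + 2) hi m * rElt d u i hi = tpow u i (by omega) m * rElt d u i hi := by
  rw [← tpow_succ_mul_rElt, rElt_eq, (commute_e_e _ hi).eq, mul_smul_comm, mul_smul_comm]
  simp only [← mul_assoc]
  rw [tpow_succ_mul_e hi]

theorem mul_rElt_zero_mem_span (a : Y d 3 u) :
    a * rElt d u 0 (by omega) ∈ Submodule.span ℂ (Set.range fun k : ZMod d =>
      tpow u 0 (by omega) k * (rElt d u 0 (by omega) : Y d 3 u)) := by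
  set f : ZMod d → Y d 3 u := fun k => tpow u 0 (by omega) k * rElt d u 0 (by omega)
  set V := Submodule.span ℂ (Set.range f)
  have mul_mem {b : Y d 3 u} (hb : ∀ k, b * f k ∈ V) {y} (hy : y ∈ V) : b * y ∈ V :=
    (Submodule.span_le (p := V.comap (LinearMap.mulLeft ℂ b))).2 (Set.range_subset_iff.2 hb) hy
  have g_mul_mem (i hi k) : g d u i hi * f k ∈ V := by
    have hf : g d u i hi * f k = u • f k := by
      obtain rfl | rfl : i = 0 ∨ i = 1 := by omega
      · rw [← mul_assoc, g_mul_tpow, mul_assoc, g_mul_rElt, mul_smul_comm, tpow_succ_mul_rElt]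
      · rw [← mul_assoc, (commute_g_tpow _ _ (by omega) (by omega) k).eq, mul_assoc,
          g_succ_mul_rElt (Nat.lt_succ_self 2), mul_smul_comm]
    exact hf ▸ V.smul_mem u (Submodule.subset_span ⟨k, rfl⟩)
  have t_mul_mem (j hj k) : t d u j hj * f k ∈ V := by
    have hr : tpow u j hj (1 : ZMod d) * rElt d u 0 (by omega)
        = tpow u 0 (by omega) (1 : ZMod d) * (rElt d u 0 (by omega) : Y d 3 u) := by
      obtain rfl | rfl | rfl : j = 0 ∨ j = 1 ∨ j = 2 := by omega
      · rfl
      · exact tpow_succ_mul_rElt _ 1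
      · exact tpow_add_two_mul_rElt _ 1
    have hf : t d u j hj * f k = f (k + 1) := by
      rw [t_eq_tpow_one, (commute_tpow_tpow _ _ _ _).left_comm, hr, ← mul_assoc, ← tpow_add]
    exact hf ▸ Submodule.subset_span ⟨k + 1, rfl⟩
  suffices hS : V.comap (LinearMap.mulRight ℂ (rElt d u 0 (by omega))) = ⊤ from
    Submodule.mem_comap.1 (hS ▸ Submodule.mem_top : a ∈ _)
  refine eq_top_of_generator_mul_mem ?_ (fun i hi b hb => ?_) fun j hj b hb => ?_
  · exact Submodule.subset_span ⟨0, by simp only [f, tpow_zero, LinearMap.mulRight_apply]⟩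
  · rw [Submodule.mem_comap, LinearMap.mulRight_apply, mul_assoc]
    exact mul_mem (g_mul_mem i hi) hb
  · rw [Submodule.mem_comap, LinearMap.mulRight_apply, mul_assoc]
    exact mul_mem (t_mul_mem j hj) hb

theorem cElt_eq_sum (hi : i + 2 < n) :
    cElt d u i hi = ∑ k : ZMod d, tpow u i (by omega) k * rElt d u i hi := by
  let T (a b c : ZMod d) : Y d n u :=
    tpow u i (by omega) a * tpow u (i + 1) (by omega) b * tpow u (i + 2) hi c * steinberg d u i hi
  have hT (k a b : ZMod d) :
      tpow u (i + 2) hi k * T a (b - a) (-b) = T a (b - a) (k - b) := by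
    have hcomm := (commute_tpow_tpow (u := u) hi (show i < n by omega) k a).mul_right
      (commute_tpow_tpow hi (show i + 1 < n by omega) k (b - a))
    simp only [T]
    rw [← mul_assoc, ← mul_assoc, hcomm.eq, mul_assoc _ (tpow u (i + 2) hi k), ← tpow_add,
      sub_eq_add_neg k]
  calc cElt d u i hi
      = ∑ a, ∑ b, ∑ k, T a (b - a) (k - b) := by
        refine Finset.sum_congr rfl fun a _ => ?_
        rw [← Equiv.sum_comp (Equiv.subRight a)]
        exact Finset.sum_congr rfl fun b _ => (Equiv.sum_comp (Equiv.subRight b) _).symm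
    _ = ∑ k, ∑ a, ∑ b, T a (b - a) (k - b) := by
        rw [Finset.sum_comm_cycle]
    _ = ∑ k : ZMod d, tpow u (i + 2) hi k * rElt d u i hi := by
        refine Finset.sum_congr rfl fun k _ => ?_
        simp only [rElt, Finset.mul_sum]
        exact Finset.sum_congr rfl fun a _ => Finset.sum_congr rfl fun b _ => (hT k a b).symm
    _ = ∑ k : ZMod d, tpow u i (by omega) k * rElt d u i hi :=
        Finset.sum_congr rfl fun k _ => tpow_add_two_mul_rElt hi k

theorem isUnit_gCycle (hu : u ≠ 0) (hi : i + 3 < n) : IsUnit (gCycle d u i hi) :=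
  ((isUnit_g hu _).mul (isUnit_g hu _)).mul (isUnit_g hu hi)

theorem semiconjBy_gCycle_rElt (hi : i + 3 < n) :
    SemiconjBy (gCycle d u i hi) (rElt d u i (by omega)) (rElt d u (i + 1) hi) := by
  have ht (j : ℕ) (h₁ : i ≤ j) (h₂ : j ≤ i + 2) (s : ZMod d) :=
    semiconjBy_gCycle_tpow (u := u) hi j h₁ h₂ s
  rw [SemiconjBy, rElt, rElt, Finset.mul_sum, Finset.sum_mul]
  refine Finset.sum_congr rfl fun a _ => ?_
  rw [Finset.mul_sum, Finset.sum_mul]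
  exact Finset.sum_congr rfl fun b _ => (((ht i (by omega) (by omega) a).mul_right
    (ht (i + 1) (by omega) (by omega) (b - a))).mul_right
    (ht (i + 2) (by omega) (by omega) (-b))).mul_right (semiconjBy_gCycle_steinberg hi)

theorem exists_rElt_succ_eq (hu : u ≠ 0) (hi : i + 3 < n) :
    ∃ v : (Y d n u)ˣ, rElt d u (i + 1) hi = ↑v * (rElt d u i (by omega) : Y d n u) * ↑v⁻¹ := by
  obtain ⟨v, hv⟩ := isUnit_gCycle (d := d) hu hi
  exact ⟨v, by rw [Units.eq_mul_inv_iff_mul_eq, hv, (semiconjBy_gCycle_rElt hi).eq]⟩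

end Steinberg

section Tower

variable {d n : ℕ} {u : ℂ} {i j : ℕ}

theorem incl_g (hi : i + 1 < n) : incl d n u (g d u i hi) = g d u i (by omega) :=
  (RingQuot.liftAlgHom_mkAlgHom_apply ℂ _ _ _).trans (by simp [freeIncl_fg, g])

theorem incl_t (hj : j < n) : incl d n u (t d u j hj) = t d u j (by omega) :=
  (RingQuot.liftAlgHom_mkAlgHom_apply ℂ _ _ _).trans (by simp [freeIncl_ft, t])

theorem incl_tpow (hj : j < n) (s : ZMod d) :
    incl d n u (tpow u j hj s) = tpow u j (by omega) s := by
  rw [tpow, map_pow, incl_t, tpow]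

theorem incl_eShift (hi : i + 1 < n) (m : ZMod d) :
    incl d n u (eShift u i hi m) = eShift u i (by omega) m := by
  simp only [eShift, map_smul, map_sum, map_mul, map_pow, incl_t]

theorem incl_e (hi : i + 1 < n) : incl d n u (e d u i hi) = e d u i (by omega) :=
  incl_eShift hi 0

theorem incl_steinberg (hi : i + 2 < n) :
    incl d n u (steinberg d u i hi) = steinberg d u i (by omega) := by
  simp only [steinberg, map_add, map_mul, map_one, incl_g]

theorem incl_rElt [NeZero d] (hi : i + 2 < n) :
    incl d n u (rElt d u i hi) = rElt d u i (by omega) := by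
  simp only [rElt, map_sum, map_mul, incl_tpow, incl_steinberg]

theorem commute_tpow_incl (s : ZMod d) (a : Y d n u) :
    Commute (tpow u n (by omega) s) (incl d n u a) := by
  refine commute_algHom_of_commute_generators _ (fun i hi => ?_) (fun j hj => ?_) a
  · rw [incl_g]
    exact (commute_g_tpow _ _ (by omega) (by omega) s).symm
  · rw [t_eq_tpow_one, incl_tpow]
    exact commute_tpow_tpow _ _ s 1

theorem commute_g_incl_incl (a : Y d n u) :
    Commute (g d u n (by omega)) (incl d (n + 1) u (incl d n u a)) := by
  refine commute_algHom_of_commute_generators ((incl d (n + 1) u).comp (incl d n u))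
    (fun i hi => ?_) (fun j hj => ?_) a
  · rw [AlgHom.comp_apply, incl_g, incl_g]
    exact commute_g_g _ _ (by omega)
  · rw [AlgHom.comp_apply, t_eq_tpow_one, incl_tpow, incl_tpow]
    exact commute_g_tpow _ _ (by omega) (by omega) 1

end Tower

section NormalForm

section Submodule

variable {𝕜 A ι : Type*} [CommSemiring 𝕜] [Semiring A] [Algebra 𝕜 A]

theorem span_mul_comm_of_commute {s : Set A} {N : Submodule 𝕜 A}
    (h : ∀ a ∈ s, ∀ b ∈ N, Commute a b) : Submodule.span 𝕜 s * N = N * Submodule.span 𝕜 s := by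
  refine Submodule.mul_comm_of_commute fun a hmem b hb => ?_
  induction hmem using Submodule.span_induction with
  | mem a ha => exact h a ha b hb
  | zero => exact .zero_left b
  | add _ _ _ _ h₁ h₂ => exact h₁.add_left h₂
  | smul c _ _ h₁ => exact h₁.smul_left c

theorem span_singleton_mul_span_range {a : A} {f f' : ι → A} (h : ∀ s, a * f s = f' s * a) :
    Submodule.span 𝕜 {a} * Submodule.span 𝕜 (Set.range f)
      = Submodule.span 𝕜 (Set.range f') * Submodule.span 𝕜 {a} := by
  rw [Submodule.span_mul_span, Submodule.span_mul_span, Set.singleton_mul, Set.mul_singleton,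
    ← Set.range_comp, ← Set.range_comp]
  exact congrArg _ (congrArg _ (funext h))

end Submodule

/-- The image of `Y_{d,n}(u)` in `Y_{d,n+1}(u)`. -/
noncomputable def inclRange (d n : ℕ) (u : ℂ) : Submodule ℂ (Y d (n + 1) u) :=
  (⊤ : Submodule ℂ (Y d n u)).map (incl d n u).toLinearMap

/-- The span of the powers of the last framing generator of `Y_{d,n+1}(u)`. -/
noncomputable def lastT (d n : ℕ) (u : ℂ) : Submodule ℂ (Y d (n + 1) u) :=
  Submodule.span ℂ (Set.range (tpow u n n.lt_succ_self))

/-- The line spanned by the last braiding generator of `Y_{d,n+1}(u)`, which exists for `n ≠ 0`. -/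
noncomputable def lastG (d : ℕ) (u : ℂ) : ∀ n : ℕ, Submodule ℂ (Y d (n + 1) u)
  | 0 => ⊥
  | n + 1 => Submodule.span ℂ {g d u n (Nat.lt_succ_self (n + 1))}

/-- The span in `Y_{d,n+1}(u)` of the words in which the last generators occur at most once: those
of the form `a t_{n+1}^s` or `a g_n b` with `a, b` in `Y_{d,n}(u)`. -/
noncomputable def normalSpan (d n : ℕ) (u : ℂ) : Submodule ℂ (Y d (n + 1) u) :=
  inclRange d n u * lastT d n u ⊔ inclRange d n u * lastG d u n * inclRange d n u

variable {d n : ℕ} {u : ℂ}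

theorem incl_mem_inclRange (a : Y d n u) : incl d n u a ∈ inclRange d n u :=
  Submodule.mem_map_of_mem Submodule.mem_top

theorem tpow_mem_lastT (s : ZMod d) : tpow u n n.lt_succ_self s ∈ lastT d n u :=
  Submodule.subset_span ⟨s, rfl⟩

theorem one_mem_lastT : 1 ∈ lastT d n u :=
  tpow_zero (d := d) (u := u) n.lt_succ_self ▸ tpow_mem_lastT 0

theorem inclRange_mul_inclRange : inclRange d n u * inclRange d n u = inclRange d n u := by
  have top_mul_top : (⊤ : Submodule ℂ (Y d n u)) * ⊤ = ⊤ :=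
    Submodule.eq_top_iff'.2 fun a => by
      simpa using Submodule.mul_mem_mul (Submodule.mem_top (x := a)) (Submodule.mem_top (x := 1))
  rw [inclRange, ← Submodule.map_mul, top_mul_top]

theorem lastT_mul_inclRange : lastT d n u * inclRange d n u = inclRange d n u * lastT d n u := by
  refine span_mul_comm_of_commute ?_
  rintro _ ⟨s, rfl⟩ _ ⟨a, -, rfl⟩
  exact commute_tpow_incl s a

theorem lastG_mul_map_inclRange :
    lastG d u (n + 1) * (inclRange d n u).map (incl d (n + 1) u).toLinearMap
      = (inclRange d n u).map (incl d (n + 1) u).toLinearMap * lastG d u (n + 1) := by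
  refine span_mul_comm_of_commute ?_
  rintro _ rfl _ ⟨_, ⟨a, -, rfl⟩, rfl⟩
  exact commute_g_incl_incl a

theorem map_lastT : (lastT d n u).map (incl d (n + 1) u).toLinearMap
    = Submodule.span ℂ (Set.range (tpow u n (by omega))) := by
  rw [lastT, Submodule.map_span, ← Set.range_comp]
  exact congrArg _ (congrArg _ (funext fun s => incl_tpow _ s))

theorem lastG_mul_lastT : lastG d u (n + 1) * lastT d (n + 1) u
    = (lastT d n u).map (incl d (n + 1) u).toLinearMap * lastG d u (n + 1) := by
  rw [map_lastT]
  exact span_singleton_mul_span_range (g_mul_tpow_succ _)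

theorem lastG_mul_map_lastT :
    lastG d u (n + 1) * (lastT d n u).map (incl d (n + 1) u).toLinearMap
      = lastT d (n + 1) u * lastG d u (n + 1) := by
  rw [map_lastT]
  exact span_singleton_mul_span_range (g_mul_tpow _)

theorem lastG_mul_map_lastG_mul_lastG :
    lastG d u (n + 1) * (lastG d u n).map (incl d (n + 1) u).toLinearMap * lastG d u (n + 1)
      = (lastG d u n).map (incl d (n + 1) u).toLinearMap * lastG d u (n + 1)
        * (lastG d u n).map (incl d (n + 1) u).toLinearMap := by
  cases n with
  | zero => simp [lastG]
  | succ n =>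
    simp only [lastG, Submodule.map_span, Set.image_singleton, Submodule.span_mul_span,
      Set.singleton_mul_singleton, AlgHom.toLinearMap_apply, incl_g, g_braid]

theorem one_mem_normalSpan : 1 ∈ normalSpan d n u :=
  le_sup_left (a := inclRange d n u * lastT d n u) <| by
    simpa using Submodule.mul_mem_mul (incl_mem_inclRange 1) one_mem_lastT

theorem inclRange_mul_normalSpan : inclRange d n u * normalSpan d n u = normalSpan d n u := by
  simp only [normalSpan, Submodule.mul_sup, ← mul_assoc, inclRange_mul_inclRange]

theorem normalSpan_mul_inclRange : normalSpan d n u * inclRange d n u = normalSpan d n u := by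
  simp only [normalSpan, Submodule.sup_mul, mul_assoc, inclRange_mul_inclRange,
    lastT_mul_inclRange]
  rw [← mul_assoc, inclRange_mul_inclRange]

theorem map_le_inclRange (S : Submodule ℂ (Y d n u)) :
    S.map (incl d n u).toLinearMap ≤ inclRange d n u :=
  Submodule.map_mono le_top

theorem lastT_mul_lastG_le : lastT d n u * lastG d u n ≤ lastG d u n * inclRange d n u := by
  cases n with
  | zero => simp [lastG]
  | succ n =>
    rw [← lastG_mul_map_lastT]
    gcongr
    exact map_le_inclRange _

theorem lastG_mul_inclRange_mul_lastT_le :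
    lastG d u (n + 1) * (inclRange d (n + 1) u * lastT d (n + 1) u) ≤ normalSpan d (n + 1) u := by
  rw [← lastT_mul_inclRange, ← mul_assoc, lastG_mul_lastT]
  refine le_sup_of_le_right ?_
  gcongr
  exact map_le_inclRange _

theorem inclRange_eq_of_normalSpan_eq_top (h : normalSpan d n u = ⊤) :
    inclRange d (n + 1) u = (inclRange d n u).map (incl d (n + 1) u).toLinearMap
        * (lastT d n u).map (incl d (n + 1) u).toLinearMap
      ⊔ (inclRange d n u).map (incl d (n + 1) u).toLinearMap
        * (lastG d u n).map (incl d (n + 1) u).toLinearMap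
        * (inclRange d n u).map (incl d (n + 1) u).toLinearMap := by
  rw [← Submodule.map_mul, ← Submodule.map_mul, ← Submodule.map_mul, ← Submodule.map_sup]
  exact congrArg _ h.symm

variable [NeZero d]

theorem lastT_mul_lastT_le : lastT d n u * lastT d n u ≤ lastT d n u := by
  rw [lastT, Submodule.span_mul_span, Submodule.span_le, Set.mul_subset_iff]
  rintro _ ⟨a, rfl⟩ _ ⟨b, rfl⟩
  rw [← tpow_add]
  exact tpow_mem_lastT (a + b)

theorem lastT_mul_normalSpan_le : lastT d n u * normalSpan d n u ≤ normalSpan d n u := by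
  simp only [normalSpan, Submodule.mul_sup, ← mul_assoc, lastT_mul_inclRange]
  refine sup_le_sup ?_ ?_
  · rw [mul_assoc]
    gcongr
    exact lastT_mul_lastT_le
  · calc inclRange d n u * lastT d n u * lastG d u n * inclRange d n u
        = inclRange d n u * (lastT d n u * lastG d u n) * inclRange d n u := by
          simp only [mul_assoc]
      _ ≤ inclRange d n u * (lastG d u n * inclRange d n u) * inclRange d n u := by
          exact mul_le_mul_left (mul_le_mul_right lastT_mul_lastG_le _) _
      _ = inclRange d n u * lastG d u n * inclRange d n u := by
          rw [← mul_assoc, mul_assoc _ (inclRange d n u), inclRange_mul_inclRange]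

theorem lastG_mul_lastG_le :
    lastG d u (n + 1) * lastG d u (n + 1) ≤ normalSpan d (n + 1) u := by
  have hg : g d u n (by omega) ∈ lastG d u (n + 1) := Submodule.mem_span_singleton_self _
  have he : e d u n (by omega) ∈ inclRange d (n + 1) u * lastT d (n + 1) u := by
    rw [e_eq_sum]
    refine Submodule.smul_mem _ _ (Submodule.sum_mem _ fun s _ => ?_)
    rw [← incl_tpow n.lt_succ_self]
    exact Submodule.mul_mem_mul (incl_mem_inclRange _) (tpow_mem_lastT _)
  have heg : e d u n (by omega) * g d u n (by omega) ∈ normalSpan d (n + 1) u := by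
    have hle : inclRange d (n + 1) u * lastT d (n + 1) u * lastG d u (n + 1)
        ≤ inclRange d (n + 1) u * lastG d u (n + 1) * inclRange d (n + 1) u := by
      rw [mul_assoc, mul_assoc]
      exact mul_le_mul_right lastT_mul_lastG_le _
    exact Submodule.mem_sup_right (hle (Submodule.mul_mem_mul he hg))
  rw [lastG, Submodule.span_mul_span, Submodule.span_le, Set.singleton_mul_singleton,
    Set.singleton_subset_iff, g_mul_g]
  exact add_mem (add_mem one_mem_normalSpan (Submodule.smul_mem _ _ (Submodule.mem_sup_left he)))
    (Submodule.smul_mem _ _ heg)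

theorem lastG_mul_inclRange_mul_lastG_le (h : normalSpan d n u = ⊤) :
    lastG d u (n + 1) * inclRange d (n + 1) u * lastG d u (n + 1) ≤ normalSpan d (n + 1) u := by
  set G := lastG d u (n + 1)
  set A := inclRange d (n + 1) u with hA
  set A' := (inclRange d n u).map (incl d (n + 1) u).toLinearMap
  set T' := (lastT d n u).map (incl d (n + 1) u).toLinearMap
  set G' := (lastG d u n).map (incl d (n + 1) u).toLinearMap
  have hGA' : G * A' = A' * G := lastG_mul_map_inclRange
  have hA'A : A' ≤ A := map_le_inclRange _
  have hG'A : G' ≤ A := map_le_inclRange _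
  have hAA : A * A = A := inclRange_mul_inclRange
  rw [hA, inclRange_eq_of_normalSpan_eq_top h, Submodule.mul_sup, Submodule.sup_mul]
  refine sup_le ?_ ?_
  · calc G * (A' * T') * G
        = A' * (G * T') * G := by rw [← mul_assoc, hGA', mul_assoc A']
      _ = A' * (lastT d (n + 1) u * (G * G)) := by
          rw [lastG_mul_map_lastT, mul_assoc, mul_assoc]
      _ ≤ A * (lastT d (n + 1) u * normalSpan d (n + 1) u) := by
          gcongr
          exact lastG_mul_lastG_le
      _ ≤ A * normalSpan d (n + 1) u := by
          gcongr
          exact lastT_mul_normalSpan_le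
      _ = normalSpan d (n + 1) u := inclRange_mul_normalSpan
  · calc G * (A' * G' * A') * G
        = A' * (G * G' * G) * A' := by
          rw [mul_assoc, mul_assoc, ← hGA', ← mul_assoc, ← mul_assoc, ← mul_assoc, ← mul_assoc,
            hGA']
          simp only [mul_assoc]
      _ = A' * G' * G * (G' * A') := by
          rw [lastG_mul_map_lastG_mul_lastG]
          simp only [mul_assoc, G, G']
      _ ≤ A * A * G * (A * A) := by gcongr
      _ = A * G * A := by rw [hAA]
      _ ≤ normalSpan d (n + 1) u := le_sup_right

theorem lastG_mul_normalSpan_le (h : normalSpan d n u = ⊤) :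
    lastG d u (n + 1) * normalSpan d (n + 1) u ≤ normalSpan d (n + 1) u := by
  nth_rw 1 [normalSpan]
  rw [Submodule.mul_sup]
  refine sup_le lastG_mul_inclRange_mul_lastT_le ?_
  rw [← mul_assoc, ← mul_assoc, ← normalSpan_mul_inclRange]
  gcongr
  exact lastG_mul_inclRange_mul_lastG_le h

theorem normalSpan_eq_top : normalSpan d n u = ⊤ := by
  have incl_mul_mem {n : ℕ} (a : Y d n u) {b} (hb : b ∈ normalSpan d n u) :
      incl d n u a * b ∈ normalSpan d n u :=
    inclRange_mul_normalSpan.le (Submodule.mul_mem_mul (incl_mem_inclRange a) hb)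
  have t_mul_mem {n j : ℕ} (hj : j < n + 1) {b} (hb : b ∈ normalSpan d n u) :
      t d u j hj * b ∈ normalSpan d n u := by
    obtain hj' | rfl := Nat.lt_succ_iff_lt_or_eq.1 hj
    · rw [← incl_t hj']
      exact incl_mul_mem _ hb
    · rw [t_eq_tpow_one]
      exact lastT_mul_normalSpan_le (Submodule.mul_mem_mul (tpow_mem_lastT 1) hb)
  induction n with
  | zero =>
    exact eq_top_of_generator_mul_mem one_mem_normalSpan (by omega) fun j hj b => t_mul_mem hj
  | succ n ih =>
    refine eq_top_of_generator_mul_mem one_mem_normalSpan (fun i hi b hb => ?_)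
      fun j hj b => t_mul_mem hj
    obtain hi' | rfl : i + 1 < n + 1 ∨ i = n := by omega
    · rw [← incl_g hi']
      exact incl_mul_mem _ hb
    · exact lastG_mul_normalSpan_le ih
        (Submodule.mul_mem_mul (Submodule.mem_span_singleton_self _) hb)

theorem eq_top_of_normalForm_mem {S : Submodule ℂ (Y d (n + 2) u)}
    (ht : ∀ a s, incl d (n + 1) u a * tpow u (n + 1) (by omega) s ∈ S)
    (hg : ∀ a b, incl d (n + 1) u a * g d u n (by omega) * incl d (n + 1) u b ∈ S) : S = ⊤ := by
  rw [← top_le_iff, ← normalSpan_eq_top]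
  rw [normalSpan, lastT, lastG, ← Submodule.span_eq (inclRange d (n + 1) u)]
  refine sup_le ?_ ?_
  · rw [Submodule.span_mul_span, Submodule.span_le, Set.mul_subset_iff]
    rintro _ ⟨a, -, rfl⟩ _ ⟨s, rfl⟩
    exact ht a s
  · rw [Submodule.span_mul_span, Submodule.span_mul_span, Submodule.span_le, Set.mul_singleton,
      Set.mul_subset_iff]
    rintro _ ⟨_, ⟨a, -, rfl⟩, rfl⟩ _ ⟨b, -, rfl⟩
    exact hg a b

end NormalForm

section MarkovTrace

/-- The convolution `k ↦ ∑ x_i y_j`, over `i + j = k`, parametrised by `i = k + s` and `j = -s` as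
in the definition of `EShift`. -/
def conv {G R : Type*} [Fintype G] [AddGroup G] [NonUnitalNonAssocSemiring R] (x y : G → R)
    (k : G) : R :=
  ∑ s : G, x (k + s) * y (-s)

namespace IsMarkovTrace

variable {d : ℕ} {u z : ℂ} {x : ZMod d → ℂ} {tr : ∀ n : ℕ, Y d n u →ₗ[ℂ] ℂ} {n : ℕ}

theorem tr_eq_of_incl_eq (h : IsMarkovTrace d u z x tr) {m : ℕ} (a : ∀ n, m ≤ n → Y d n u)
    (ha : ∀ n hn, YokonumaHecke.incl d n u (a n hn) = a (n + 1) (by omega)) (hn : m ≤ n) :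
    tr n (a n hn) = tr m (a m le_rfl) := by
  induction n, hn using Nat.le_induction with
  | base => rfl
  | succ n hn ih => rw [← ha n hn, h.incl, ih]

theorem tr_tpow_zero (h : IsMarkovTrace d u z x tr) (s : ZMod d) :
    tr 1 (tpow u 0 (by omega) s) = x s := by
  simpa only [map_one, one_mul, h.one, mul_one] using h.framing 0 1 s

variable [NeZero d]

theorem tr_incl_mul_e (h : IsMarkovTrace d u z x tr) (w : Y d (n + 1) u) :
    tr (n + 2) (YokonumaHecke.incl d (n + 1) u w * e d u n (by omega))
      = (1 / (d : ℂ)) * ∑ s, tr (n + 1) (w * tpow u n (by omega) s) * x (-s) := by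
  rw [e_eq_sum, mul_smul_comm, map_smul, smul_eq_mul, Finset.mul_sum, map_sum]
  congr 1
  refine Finset.sum_congr rfl fun s _ => ?_
  rw [← incl_tpow n.lt_succ_self, ← mul_assoc, ← map_mul, h.framing, mul_comm]

theorem tr_incl_mul_e_mul_g (h : IsMarkovTrace d u z x tr) (w : Y d (n + 1) u) :
    tr (n + 2) (YokonumaHecke.incl d (n + 1) u w * (e d u n (by omega) * g d u n (by omega)))
      = z * tr (n + 1) w := by
  have hs (s : ZMod d) : tr (n + 2) (YokonumaHecke.incl d (n + 1) u w *
      (tpow u n (by omega) s * tpow u (n + 1) (by omega) (-s) * g d u n (by omega)))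
        = z * tr (n + 1) w := by
    rw [mul_assoc, ← g_mul_tpow, ← mul_assoc, ← mul_assoc, ← incl_tpow n.lt_succ_self,
      ← incl_tpow n.lt_succ_self, h.comm, ← mul_assoc, ← map_mul, ← map_mul, h.markov, h.comm,
      mul_assoc, ← tpow_add, add_neg_cancel, tpow_zero, mul_one]
  rw [e_eq_sum, smul_mul_assoc, mul_smul_comm, Finset.sum_mul, Finset.mul_sum, map_smul, map_sum]
  simp only [hs]
  exact one_div_smul_sum_const _

theorem tr_incl_mul_e_mul_g_mul_incl (h : IsMarkovTrace d u z x tr) (a b : Y d (n + 1) u) :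
    tr (n + 2) (YokonumaHecke.incl d (n + 1) u a * (e d u n (by omega) * g d u n (by omega))
      * YokonumaHecke.incl d (n + 1) u b) = z * tr (n + 1) (a * b) := by
  rw [h.comm, ← mul_assoc, ← map_mul, h.tr_incl_mul_e_mul_g, h.comm]

theorem tr_incl_mul_e_mul_e_mul_steinberg (h : IsMarkovTrace d u z x tr) (a : Y d (n + 2) u) :
    tr (n + 3) (YokonumaHecke.incl d (n + 2) u a
        * (e d u n (by omega) * e d u (n + 1) (by omega) * steinberg d u n (by omega)))
      = tr (n + 3) (YokonumaHecke.incl d (n + 2) u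
          (a * (e d u n (by omega) * (1 + g d u n (by omega)))) * e d u (n + 1) (by omega))
        + (u + 1) * z * tr (n + 2) (a * (e d u n (by omega) * (1 + g d u n (by omega)))) := by
  set b := a * (e d u n (by omega) * (1 + g d u n (by omega))) with hb
  have hbg : b * g d u n (by omega) = u • b := by
    rw [hb, mul_assoc, e_mul_one_add_g_mul_g, mul_smul_comm]
  have expand : YokonumaHecke.incl d (n + 2) u a
        * (e d u n (by omega) * e d u (n + 1) (by omega) * steinberg d u n (by omega))
      = YokonumaHecke.incl d (n + 2) u b * e d u (n + 1) (by omega)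
        + YokonumaHecke.incl d (n + 2) u b * (e d u (n + 1) (by omega) * g d u (n + 1) (by omega))
        + YokonumaHecke.incl d (n + 2) u b * (e d u (n + 1) (by omega) * g d u (n + 1) (by omega))
          * YokonumaHecke.incl d (n + 2) u (g d u n (by omega)) := by
    have hcomm : Commute (1 + g d u n (by omega))
        (e d u n (by omega) * e d u (n + 1) (by omega) : Y d (n + 3) u) :=
      (Commute.one_left _).add_left (commute_g_e_mul_e (by omega))
    rw [steinberg_eq_one_add_g_mul, ← mul_assoc _ (1 + _), ← hcomm.eq, ← mul_assoc (1 + _),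
      ((Commute.one_left _).add_left (commute_g_e _)).eq, hb]
    simp only [map_mul, map_add, map_one, incl_e, incl_g]
    noncomm_ring
  rw [expand, map_add, map_add, h.tr_incl_mul_e_mul_g, h.tr_incl_mul_e_mul_g_mul_incl, hbg,
    map_smul, smul_eq_mul]
  ring

theorem tr_tpow_mul_e (h : IsMarkovTrace d u z x tr) (k : ZMod d) :
    tr 2 (tpow u 0 (by omega) k * e d u 0 (by omega)) = EShift x k := by
  rw [← incl_tpow Nat.zero_lt_one, h.tr_incl_mul_e (n := 0), EShift]
  simp only [← tpow_add, h.tr_tpow_zero]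

theorem tr_tpow_mul_e_mul_one_add_g (h : IsMarkovTrace d u z x tr) (k : ZMod d) :
    tr 2 (tpow u 0 (by omega) k * (e d u 0 (by omega) * (1 + g d u 0 (by omega))))
      = EShift x k + z * x k := by
  rw [mul_one_add, mul_add, map_add, h.tr_tpow_mul_e, ← incl_tpow Nat.zero_lt_one,
    h.tr_incl_mul_e_mul_g (n := 0), h.tr_tpow_zero]

theorem tr_tpow_mul_rElt_three (h : IsMarkovTrace d u z x tr) (k : ZMod d) :
    tr 3 (tpow u 0 (by omega) k * rElt d u 0 (by omega))
      = (d : ℂ) ^ 2 * ((u + 1) * z ^ 2 * x k + (u + 2) * z * EShift x k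
        + (1 / (d : ℂ)) * conv (EShift x) x k) := by
  have hs (s : ZMod d) :
      tr 2 (tpow u 0 (by omega) k * (e d u 0 (by omega) * (1 + g d u 0 (by omega)))
        * tpow u 1 (by omega) s) = EShift x (k + s) + z * x (k + s) := by
    rw [mul_assoc, e_mul_one_add_g_mul_tpow_succ Nat.one_lt_two, ← mul_assoc, ← tpow_add,
      h.tr_tpow_mul_e_mul_one_add_g]
  have hd : (d : ℂ) ≠ 0 := NeZero.ne _
  rw [rElt_eq, mul_smul_comm, map_smul, smul_eq_mul, ← incl_tpow Nat.zero_lt_two,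
    h.tr_incl_mul_e_mul_e_mul_steinberg (n := 0), h.tr_incl_mul_e (n := 1),
    h.tr_tpow_mul_e_mul_one_add_g, Finset.sum_congr rfl fun s _ => congrArg (· * x (-s)) (hs s)]
  simp only [add_mul, mul_assoc, Finset.sum_add_distrib, ← Finset.mul_sum]
  rw [conv, EShift]
  field_simp
  ring

theorem tr_tpow_mul_rElt (h : IsMarkovTrace d u z x tr) (k : ZMod d) (hn : 3 ≤ n) :
    tr n (tpow u 0 (by omega) k * rElt d u 0 (by omega))
      = (d : ℂ) ^ 2 * ((u + 1) * z ^ 2 * x k + (u + 2) * z * EShift x k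
        + (1 / (d : ℂ)) * conv (EShift x) x k) := by
  rw [← h.tr_tpow_mul_rElt_three]
  exact h.tr_eq_of_incl_eq (fun n hn => tpow u 0 (by omega) k * rElt d u 0 (by omega))
    (fun n hn => by rw [map_mul, incl_tpow, incl_rElt]) hn

theorem tr_eShift_mul_eShift (h : IsMarkovTrace d u z x tr) (k : ZMod d) (hn : 1 + 1 < n) :
    tr n (eShift u 0 (by omega) k * eShift u 1 hn (0 : ZMod d))
      = (1 / (d : ℂ)) * conv (EShift x) x k := by
  have hs (s : ZMod d) :
      tr 2 (eShift u 0 (by omega) k * tpow u 1 (by omega) s) = EShift x (k + s) := by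
    rw [eShift_eq_tpow_mul_e, mul_assoc, ← (commute_tpow_e _ _ s).eq,
      tpow_succ_mul_e Nat.one_lt_two, ← mul_assoc, ← tpow_add, h.tr_tpow_mul_e]
  refine (h.tr_eq_of_incl_eq (m := 3)
    (fun n (hn : 1 + 1 < n) => eShift u 0 (by omega) k * e d u 1 hn)
    (fun n hn => by rw [map_mul, incl_eShift, incl_e]) hn).trans ?_
  rw [← incl_eShift Nat.one_lt_two, h.tr_incl_mul_e (n := 1)]
  simp only [hs, conv]

theorem tr_mul_incl_eq_zero (h : IsMarkovTrace d u z x tr) {b : Y d (n + 1) u}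
    (hb : ∀ a, tr (n + 1) (a * b) = 0) (a : Y d (n + 2) u) :
    tr (n + 2) (a * YokonumaHecke.incl d (n + 1) u b) = 0 := by
  let S : Submodule ℂ (Y d (n + 2) u) :=
    LinearMap.ker (tr (n + 2) ∘ₗ LinearMap.mulRight ℂ (YokonumaHecke.incl d (n + 1) u b))
  suffices hS : S = ⊤ from LinearMap.mem_ker.1 (hS ▸ Submodule.mem_top : a ∈ S)
  refine eq_top_of_normalForm_mem (fun a s => ?_) fun a c => ?_
  · change tr (n + 2) (_ * _) = 0
    rw [mul_assoc, (commute_tpow_incl s b).eq, ← mul_assoc, ← map_mul, h.framing, hb, mul_zero]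
  · change tr (n + 2) (_ * _) = 0
    rw [h.comm, ← mul_assoc, ← mul_assoc, ← map_mul, h.comm, ← mul_assoc, ← map_mul, h.markov,
      ← mul_assoc, h.comm, ← mul_assoc, hb, mul_zero]

theorem tr_mul_rElt_zero_eq_zero (h : IsMarkovTrace d u z x tr)
    (hk : ∀ k : ZMod d, tr 3 (tpow u 0 (by omega) k * rElt d u 0 (by omega)) = 0) (hn : 3 ≤ n)
    (a : Y d n u) : tr n (a * rElt d u 0 (by omega)) = 0 := by
  induction n, hn using Nat.le_induction with
  | base =>
    have hle : Submodule.span ℂ (Set.range fun k : ZMod d =>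
        tpow u 0 (by omega) k * rElt d u 0 (by omega)) ≤ LinearMap.ker (tr 3) :=
      Submodule.span_le.2 (Set.range_subset_iff.2 hk)
    exact hle (mul_rElt_zero_mem_span a)
  | succ n hn ih =>
    obtain ⟨n, rfl⟩ := Nat.exists_eq_succ_of_ne_zero (show n ≠ 0 by omega)
    rw [← incl_rElt]
    exact h.tr_mul_incl_eq_zero ih a

theorem tr_mul_rElt_eq_zero (h : IsMarkovTrace d u z x tr) (hu : u ≠ 0)
    (hk : ∀ k : ZMod d, tr 3 (tpow u 0 (by omega) k * rElt d u 0 (by omega)) = 0) {i : ℕ}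
    (hi : i + 2 < n) (a : Y d n u) : tr n (a * rElt d u i hi) = 0 := by
  induction i generalizing a with
  | zero => exact h.tr_mul_rElt_zero_eq_zero hk hi a
  | succ i ih =>
    obtain ⟨v, hv⟩ := exists_rElt_succ_eq (d := d) hu hi
    rw [hv, ← mul_assoc, h.comm, ← mul_assoc, ← mul_assoc]
    exact ih _ _

end IsMarkovTrace

end MarkovTrace

section Ideals

theorem exists_comp_eq_iff_ker_le_ker {𝕜 M N P : Type*} [Ring 𝕜] [AddCommGroup M] [AddCommGroup N]
    [AddCommGroup P] [Module 𝕜 M] [Module 𝕜 N] [Module 𝕜 P] {p : M →ₗ[𝕜] N}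
    (hp : Function.Surjective p) (τ : M →ₗ[𝕜] P) :
    (∃ f : N →ₗ[𝕜] P, f ∘ₗ p = τ) ↔ LinearMap.ker p ≤ LinearMap.ker τ := by
  constructor
  · rintro ⟨f, rfl⟩
    exact LinearMap.ker_le_ker_comp p f
  · intro h
    refine ⟨(LinearMap.ker p).liftQ τ h ∘ₗ (p.quotKerEquivOfSurjective hp).symm, ?_⟩
    ext y
    simp

theorem exists_comp_mkₐ_eq_iff {𝕜 R M : Type*} [CommRing 𝕜] [Ring R] [Algebra 𝕜 R]
    [AddCommGroup M] [Module 𝕜 M] (I : TwoSidedIdeal R) (τ : R →ₗ[𝕜] M) :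
    (∃ f : I.ringCon.Quotient →ₗ[𝕜] M, f ∘ₗ (I.ringCon.mkₐ (α := 𝕜)).toLinearMap = τ)
      ↔ ∀ y ∈ I, τ y = 0 := by
  have mem_ker (y : R) : y ∈ LinearMap.ker (I.ringCon.mkₐ (α := 𝕜)).toLinearMap ↔ y ∈ I :=
    (RingCon.eq I.ringCon).trans (I.mem_iff y).symm
  rw [exists_comp_eq_iff_ker_le_ker (RingCon.mkₐ_surjective (α := 𝕜) _)]
  simp only [SetLike.le_def, mem_ker, LinearMap.mem_ker]

theorem forall_mem_span_eq_zero_iff {R M F : Type*} [Ring R] [AddCommGroup M] [FunLike F R M]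
    [AddMonoidHomClass F R M] (τ : F) (hτ : ∀ a b, τ (a * b) = τ (b * a)) (s : Set R) :
    (∀ y ∈ TwoSidedIdeal.span s, τ y = 0) ↔ ∀ y ∈ s, ∀ a, τ (a * y) = 0 := by
  constructor
  · intro h y hy a
    exact h _ (TwoSidedIdeal.mul_mem_left _ _ _ (TwoSidedIdeal.subset_span hy))
  · intro h y hy
    let J : TwoSidedIdeal R := TwoSidedIdeal.mk' {y | ∀ a, τ (a * y) = 0}
      (fun a => by rw [mul_zero, map_zero])
      (fun hx hy a => by rw [mul_add, map_add, hx a, hy a, add_zero])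
      (fun hx a => by rw [mul_neg, map_neg, hx a, neg_zero])
      (fun hy a => by rw [← mul_assoc]; exact hy _)
      (fun hx a => by rw [← mul_assoc, hτ, ← mul_assoc]; exact hx _)
    have mem_J (y : R) : y ∈ J ↔ ∀ a, τ (a * y) = 0 := TwoSidedIdeal.mem_mk' _ _ _ _ _ _ y
    have hJ : y ∈ J := TwoSidedIdeal.span_le.2 (fun y hy => (mem_J y).2 (h y hy)) hy
    simpa only [one_mul] using (mem_J y).1 hJ 1

variable {d : ℕ} [NeZero d] {n : ℕ} {u : ℂ}

theorem ctlIdeal_le_ftlIdeal : ctlIdeal d n u ≤ ftlIdeal d n u := by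
  refine TwoSidedIdeal.span_le.2 ?_
  rintro _ ⟨i, hi, rfl⟩
  rw [cElt_eq_sum]
  exact sum_mem fun k _ => TwoSidedIdeal.mul_mem_left _ _ _ (TwoSidedIdeal.subset_span ⟨i, hi, rfl⟩)

theorem PassesToFTL.passesToCTL {τ : Y d n u →ₗ[ℂ] ℂ} (h : PassesToFTL τ) : PassesToCTL τ :=
  (exists_comp_mkₐ_eq_iff _ τ).2 fun y hy =>
    (exists_comp_mkₐ_eq_iff _ τ).1 h y (ctlIdeal_le_ftlIdeal hy)

theorem IsMarkovTrace.passesToFTL_iff {z : ℂ} {x : ZMod d → ℂ} {tr : ∀ n : ℕ, Y d n u →ₗ[ℂ] ℂ}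
    (h : IsMarkovTrace d u z x tr) (hu : u ≠ 0) (hn : 3 ≤ n) :
    PassesToFTL (tr n) ↔ ∀ k : ZMod d, (u + 1) * z ^ 2 * x k + (u + 2) * z * EShift x k
      + (1 / (d : ℂ)) * conv (EShift x) x k = 0 := by
  have hd : (d : ℂ) ^ 2 ≠ 0 := pow_ne_zero _ (NeZero.ne _)
  rw [PassesToFTL, exists_comp_mkₐ_eq_iff, ftlIdeal, forall_mem_span_eq_zero_iff _ (h.comm n)]
  constructor
  · intro hr k
    have hk := hr _ ⟨0, hn, rfl⟩ (tpow u 0 (by omega) k)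
    rwa [h.tr_tpow_mul_rElt k hn, mul_eq_zero_iff_left hd] at hk
  · rintro hk _ ⟨i, hi, rfl⟩ a
    refine h.tr_mul_rElt_eq_zero hu (fun k => ?_) hi a
    rw [h.tr_tpow_mul_rElt_three, hk, mul_zero]

end Ideals

section Fourier

variable {d : ℕ} [NeZero d]

theorem dft_conv {A : Type*} [Ring A] [Algebra ℂ A] (x y : ZMod d → A) (m : ZMod d) :
    ZMod.dft (conv x y) m = ZMod.dft x m * ZMod.dft y m := by
  have hchar (k s : ZMod d) : (ZMod.stdAddChar (-((k - s) * m)) : ℂ)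
      = ZMod.stdAddChar (-(k * m)) * ZMod.stdAddChar (-(-s * m)) := by
    rw [← AddChar.map_add_eq_mul]
    congr 1
    ring
  calc ZMod.dft (conv x y) m
      = ∑ s, ∑ k, ZMod.stdAddChar (-(k * m)) • (x (k + s) * y (-s)) := by
        rw [ZMod.dft_apply, Finset.sum_comm]
        simp only [conv, Finset.smul_sum]
    _ = ∑ s, ∑ k, ZMod.stdAddChar (-((k - s) * m)) • (x k * y (-s)) := by
        refine Finset.sum_congr rfl fun s _ => ?_
        rw [← Equiv.sum_comp (Equiv.subRight s)]
        simp only [Equiv.subRight_apply, sub_add_cancel]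
    _ = ∑ s, ZMod.dft x m * (ZMod.stdAddChar (-(-s * m)) • y (-s)) := by
        simp only [hchar, ← smul_mul_smul_comm, ← Finset.sum_mul, ZMod.dft_apply]
    _ = ZMod.dft x m * ZMod.dft y m := by
        rw [← Finset.mul_sum, ZMod.dft_apply y, ← Equiv.sum_comp (Equiv.neg _)]
        simp only [Equiv.neg_apply, neg_neg]

theorem EShift_eq_smul_conv (x : ZMod d → ℂ) : EShift x = (1 / (d : ℂ)) • conv x x :=
  rfl

theorem forall_equation_iff_forall_dft (u z : ℂ) (x : ZMod d → ℂ) :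
    (∀ k : ZMod d, (u + 1) * z ^ 2 * x k + (u + 2) * z * EShift x k
      + (1 / (d : ℂ)) * conv (EShift x) x k = 0) ↔
    ∀ m : ZMod d, ZMod.dft x m = 0 ∨ ZMod.dft x m = -(d * z) ∨
      ZMod.dft x m = -(d * z) * (u + 1) := by
  have hd : (d : ℂ) ≠ 0 := NeZero.ne _
  let F : ZMod d → ℂ := ((u + 1) * z ^ 2) • x + ((u + 2) * z) • EShift x
    + (1 / (d : ℂ)) • conv (EShift x) x
  have dft_F (m : ZMod d) : ZMod.dft F m = 1 / (d : ℂ) ^ 2 * (ZMod.dft x m *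
      ((ZMod.dft x m - -(d * z)) * (ZMod.dft x m - -(d * z) * (u + 1)))) := by
    simp only [F, map_add, map_smul, Pi.add_apply, Pi.smul_apply, smul_eq_mul, dft_conv,
      EShift_eq_smul_conv]
    field_simp
    ring
  have hF : (∀ k : ZMod d, (u + 1) * z ^ 2 * x k + (u + 2) * z * EShift x k
      + (1 / (d : ℂ)) * conv (EShift x) x k = 0) ↔ F = 0 := funext_iff.symm
  rw [hF, ← (ZMod.dft (N := d) (E := ℂ)).map_eq_zero_iff, funext_iff]
  refine forall_congr' fun m => ?_
  rw [dft_F, Pi.zero_apply, mul_eq_zero_iff_left (one_div_ne_zero (pow_ne_zero 2 hd)), mul_eq_zero,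
    mul_eq_zero, sub_eq_zero, sub_eq_zero]

theorem forall_eq_sum_stdAddChar_iff (x c : ZMod d → ℂ) :
    (∀ k, x k = ∑ m, c m * ZMod.stdAddChar (k * m)) ↔ ∀ m, ZMod.dft x m = d * c m := by
  have hd : (d : ℂ) ≠ 0 := NeZero.ne _
  have hc (k : ZMod d) :
      ∑ m, c m * ZMod.stdAddChar (k * m) = ZMod.dft.symm ((d : ℂ) • c) k := by
    rw [map_smul, Pi.smul_apply, ZMod.invDFT_apply, smul_inv_smul₀ hd]
    exact Finset.sum_congr rfl fun m _ => by rw [smul_eq_mul, mul_comm, mul_comm k]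
  simp only [hc]
  rw [← funext_iff, LinearEquiv.eq_symm_apply, funext_iff]
  rfl

theorem forall_eq_sum_stdAddChar_mem_iff (u z : ℂ) (x : ZMod d → ℂ) (S₁ S₂ : Finset (ZMod d)) :
    (∀ k : ZMod d, x k = -z * (∑ m ∈ S₁, ZMod.stdAddChar (k * m)
      + (u + 1) * ∑ m ∈ S₂, ZMod.stdAddChar (k * m))) ↔
    ∀ m, ZMod.dft x m = -(d * z) * ((if m ∈ S₁ then 1 else 0)
      + (u + 1) * (if m ∈ S₂ then 1 else 0)) := by
  have hc (k : ZMod d) : -z * (∑ m ∈ S₁, (ZMod.stdAddChar (k * m) : ℂ)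
      + (u + 1) * ∑ m ∈ S₂, ZMod.stdAddChar (k * m))
      = ∑ m, -z * ((if m ∈ S₁ then 1 else 0) + (u + 1) * (if m ∈ S₂ then 1 else 0))
        * ZMod.stdAddChar (k * m) := by
    simp only [mul_assoc, add_mul, ite_mul, one_mul, zero_mul, ← Finset.mul_sum,
      Finset.sum_add_distrib, Finset.sum_ite_mem, Finset.univ_inter]
  simp only [hc]
  rw [forall_eq_sum_stdAddChar_iff]
  simp only [neg_mul, mul_neg, mul_assoc]

theorem card_ne_zero_and_eq_neg_one_div {u z : ℂ} {x : ZMod d → ℂ} (hx : x 0 = 1)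
    {S₁ S₂ : Finset (ZMod d)} (h : ∀ k : ZMod d, x k = -z * (∑ m ∈ S₁, ZMod.stdAddChar (k * m)
      + (u + 1) * ∑ m ∈ S₂, ZMod.stdAddChar (k * m))) :
    (S₁.card : ℂ) + (u + 1) * S₂.card ≠ 0 ∧ z = -1 / ((S₁.card : ℂ) + (u + 1) * S₂.card) := by
  have hone : 1 = -z * ((S₁.card : ℂ) + (u + 1) * S₂.card) := by
    simpa only [hx, zero_mul, AddChar.map_zero_eq_one, Finset.sum_const, nsmul_eq_mul, mul_one]
      using h 0
  have hcard : (S₁.card : ℂ) + (u + 1) * S₂.card ≠ 0 := right_ne_zero_of_mul (hone ▸ one_ne_zero)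
  refine ⟨hcard, (eq_div_iff hcard).2 ?_⟩
  linear_combination hone

theorem forall_dft_iff_supportCondition (u z : ℂ) {x : ZMod d → ℂ} (hx : x 0 = 1) :
    (∀ m : ZMod d, ZMod.dft x m = 0 ∨ ZMod.dft x m = -(d * z) ∨
      ZMod.dft x m = -(d * z) * (u + 1)) ↔ SupportCondition u z x := by
  classical
  constructor
  · intro h
    let S₁ := Finset.univ.filter fun m => ZMod.dft x m ≠ 0 ∧ ZMod.dft x m = -(d * z)
    let S₂ := Finset.univ.filter fun m => ZMod.dft x m ≠ 0 ∧ ZMod.dft x m ≠ -(d * z)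
    have mem_S₁ (m : ZMod d) : m ∈ S₁ ↔ ZMod.dft x m ≠ 0 ∧ ZMod.dft x m = -(d * z) := by simp [S₁]
    have mem_S₂ (m : ZMod d) : m ∈ S₂ ↔ ZMod.dft x m ≠ 0 ∧ ZMod.dft x m ≠ -(d * z) := by simp [S₂]
    have hdisj : Disjoint S₁ S₂ :=
      Finset.disjoint_left.2 fun m h₁ h₂ => ((mem_S₂ m).1 h₂).2 ((mem_S₁ m).1 h₁).2
    have hunion : (S₁ : Set (ZMod d)) ∪ S₂ = Function.support (ZMod.dft x) := by
      ext m
      simp only [Set.mem_union, Finset.mem_coe, mem_S₁, mem_S₂, Function.mem_support]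
      tauto
    have hsum := (forall_eq_sum_stdAddChar_mem_iff u z x S₁ S₂).2 fun m => by
      simp only [mem_S₁, mem_S₂]
      by_cases h₀ : ZMod.dft x m = 0
      · simp [h₀]
      by_cases h₁ : ZMod.dft x m = -(d * z)
      · simp [← h₁, h₀]
      · simpa [h₀, h₁] using h m
    exact ⟨S₁, S₂, hdisj, hunion, hsum, card_ne_zero_and_eq_neg_one_div hx hsum⟩
  · rintro ⟨S₁, S₂, hdisj, -, hsum, -⟩ m
    rw [(forall_eq_sum_stdAddChar_mem_iff u z x S₁ S₂).1 hsum m]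
    by_cases h₁ : m ∈ S₁
    · simp [h₁, Finset.disjoint_left.1 hdisj h₁]
    · by_cases h₂ : m ∈ S₂ <;> simp [h₁, h₂]

end Fourier

end YokonumaHecke

theorem mainTheorem4 (d : ℕ) [NeZero d] (u : ℂ) (hu : u ≠ 0) (z : ℂ) (x : ZMod d → ℂ)
    (hx : x 0 = 1) (tr : ∀ n : ℕ, YokonumaHecke.Y d n u →ₗ[ℂ] ℂ)
    (htr : YokonumaHecke.IsMarkovTrace d u z x tr) (n : ℕ) (hn : 3 ≤ n) :
    -- the trace passes to `FTL` iff the system of equations holds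
    (YokonumaHecke.PassesToFTL (tr n) ↔
      ∀ k : ZMod d,
        (u + 1) * z ^ 2 * x k + (u + 2) * z * YokonumaHecke.EShift x k
          + tr n (YokonumaHecke.eShift u 0 (by omega) k
              * YokonumaHecke.eShift u 1 (by omega) (0 : ZMod d)) = 0) ∧
    -- this is a restatement of the description by the support of the Fourier transform
    (YokonumaHecke.PassesToFTL (tr n) ↔ YokonumaHecke.SupportCondition u z x) ∧
    -- hence the trace conditions for `FTL` are contained in those for `CTL`
    (YokonumaHecke.PassesToFTL (tr n) →
      YokonumaHecke.PassesToCTL (tr n) ∧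
        (u + 1) * z ^ 2 * ∑ k : ZMod d, x k
          + (u + 2) * z * ∑ k : ZMod d, YokonumaHecke.EShift x k
          + ∑ k : ZMod d, tr n (YokonumaHecke.eShift u 0 (by omega) k
              * YokonumaHecke.eShift u 1 (by omega) (0 : ZMod d)) = 0) := by
  have hiff := htr.passesToFTL_iff hu hn
  have hsys := YokonumaHecke.forall_equation_iff_forall_dft u z x
  have htr_e (k : ZMod d) := htr.tr_eShift_mul_eShift k hn
  simp only [htr_e]
  refine ⟨hiff, hiff.trans (hsys.trans (YokonumaHecke.forall_dft_iff_supportCondition u z hx)),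
    fun h => ⟨h.passesToCTL, ?_⟩⟩
  simp only [Finset.mul_sum, ← Finset.sum_add_distrib]
  exact Finset.sum_eq_zero fun k _ => hiff.1 h k
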